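/- Let $D = x\,\frac{d}{dx}$ on $(0,\infty)$. For $k\in\mathbb N_0$, $\alpha\in\mathbb R$ and smooth $u:(0,\infty)\to\mathbb R$ put $$|u|_{k,\alpha} := \Big(\sum_{j=0}^k \int_0^\infty x^{-2\alpha}\,(D^j u)^2\,\frac{dx}{x}\Big)^{1/2}\in[0,\infty].$$ Let $$\tilde{\mathcal A} = x^{-1}D^2(D-2)^2 + x^{-2}D(D-1)(D-2)(D-3),\qquad \check{\mathcal A} = x^{-1}D^2(D-2)(D-3)+x^{-2}D(D-1)(D-3)(D-4),$$ and $\tilde w := (D-1)w$, $\check w := (D-2)(D-1)w$. For smooth $w:[0,\infty)\to\mathbb R$ (smooth up to $x=0$) write $w_j := \frac{1}{j!}w^{(j)}(0)$. Let $\gamma\in(-2,\infty)\setminus\mathbb Z$ and $k,m\in\mathbb N_0$. Set, for $i\in\{1,2\}$, $$L_i(w) := \sum_{r=0}^m \Big|\,w-\sum_{j=1}^{\lfloor\gamma\rfloor+m+r} w_j x^j\Big|_{k+4m+i,\;\gamma+m+r}$$ (sums over $j$ with upper limit $\le 0$ are empty), and $$R_1(w) := |\tilde{\mathcal A}^m\tilde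 w|_{k,\gamma}+\sum_{r=1}^m|w_{\lfloor\gamma\rfloor+m+r}|,\qquad R_2(w) := |\check{\mathcal A}^m\check w|_{k,\gamma}+\sum_{r=1}^m|w_{\lfloor\gamma\rfloor+m+r}|.$$ Then there is a constant $C<\infty$ depending only on $k$, $m$ and $\gamma$ such that for $i\in\{1,2\}$ and every smooth $w:[0,\infty)\to\mathbb R$ with $w(0)=0$ the following hold: (a) $L_i(w)\le C\,R_i(w)$, provided that $L_i(w)<\infty$ or $\gamma>i$; (b) $R_i(w)\le C\,L_i(w)$, provided that $R_i(w)<\infty$ or $\gamma<i+1$. In particular $L_i(w)$ and $R_i(w)$ are equivalent, with constants depending only on $k,m,\gamma$, for all such $w$ for which all norms occurring are finite. -/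

import Mathlib

open scoped ENNReal NNReal ContDiff

namespace ThinFilm

noncomputable section

/-- The shifted scaling-invariant derivative `D - c`, where `D = x ∂ₓ`. It is only ever evaluated
at points `x > 0`. -/
def shiftD (c : ℝ) (u : ℝ → ℝ) : ℝ → ℝ := fun x => x * deriv u x - c * u x

/-- The scaling-invariant (logarithmic) derivative `D = x ∂ₓ`. -/
def logD (u : ℝ → ℝ) : ℝ → ℝ := fun x => x * deriv u x

/-- The weighted norm `|u|_{k,α} = (∑_{j ≤ k} ∫₀^∞ x^{-2α} (D^j u)² dx/x)^{1/2}`, with values in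
`[0,∞]`. -/
def wnorm (k : ℕ) (α : ℝ) (u : ℝ → ℝ) : ℝ≥0∞ :=
  (∑ j ∈ Finset.range (k + 1),
    ∫⁻ x in Set.Ioi (0 : ℝ), ENNReal.ofReal (x ^ (-2 * α) * (logD^[j] u x) ^ 2 / x))
      ^ (1 / 2 : ℝ)

/-- The Taylor coefficient `w_j = w^{(j)}(0) / j!` of a function on `[0,∞)`, with one-sided
derivatives at `0`. -/
def coeff (w : ℝ → ℝ) (j : ℕ) : ℝ :=
  iteratedDerivWithin j w (Set.Ici 0) 0 / (j.factorial : ℝ)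

/-- `w - ∑_{j = 1}^{n} w_j x^j`; the sum is empty for `n ≤ 0`. -/
def remainder (w : ℝ → ℝ) (n : ℤ) : ℝ → ℝ :=
  fun x => w x - ∑ j ∈ Finset.Icc 1 n.toNat, coeff w j * x ^ j

/-- `w̃ = (D - 1) w`. -/
def tilde (w : ℝ → ℝ) : ℝ → ℝ := shiftD 1 w

/-- `w̌ = (D - 2) (D - 1) w`. -/
def check (w : ℝ → ℝ) : ℝ → ℝ := shiftD 2 (tilde w)

/-- `Ã = x⁻¹ p̃(D) + x⁻² q̃(D)` with `p̃(ζ) = ζ² (ζ-2)²` and `q̃(ζ) = ζ (ζ-1) (ζ-2) (ζ-3)`. -/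
def tildeA (u : ℝ → ℝ) : ℝ → ℝ := fun x =>
  x⁻¹ * logD (logD (shiftD 2 (shiftD 2 u))) x
    + (x ^ 2)⁻¹ * logD (shiftD 1 (shiftD 2 (shiftD 3 u))) x

/-- `Ǎ = x⁻¹ p̌(D) + x⁻² q̌(D)` with `p̌(ζ) = ζ² (ζ-2) (ζ-3)` and
`q̌(ζ) = ζ (ζ-1) (ζ-3) (ζ-4)`. -/
def checkA (u : ℝ → ℝ) : ℝ → ℝ := fun x =>
  x⁻¹ * logD (logD (shiftD 2 (shiftD 3 u))) x
    + (x ^ 2)⁻¹ * logD (shiftD 1 (shiftD 3 (shiftD 4 u))) x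

/-- `∑_{r = 0}^m |w - ∑_{j = 1}^{⌊γ⌋+m+r} w_j x^j|_{K, γ+m+r}`. -/
def remainderSum (K m : ℕ) (γ : ℝ) (w : ℝ → ℝ) : ℝ≥0∞ :=
  ∑ r ∈ Finset.range (m + 1), wnorm K (γ + m + r) (remainder w (⌊γ⌋ + m + r))

/-- `∑_{r = 1}^m |w_{⌊γ⌋+m+r}|`. For `γ > -2` and `1 ≤ r ≤ m` all indices `⌊γ⌋+m+r` are
nonnegative. -/
def coeffSum (m : ℕ) (γ : ℝ) (w : ℝ → ℝ) : ℝ≥0∞ :=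
  ∑ r ∈ Finset.Icc 1 m, ENNReal.ofReal |coeff w (⌊γ⌋ + m + r).toNat|

end

end ThinFilm

namespace ThinFilm

/-! ### Smooth functions of `s = log x` and products of operators `D - c`. -/

open MeasureTheory Filter Topology Asymptotics

noncomputable section

/-! In the variable `s = log x`, `D` is `d/ds` and the norms are Sobolev norms with weight `exp (-α
s)`. Both operators factor as `x⁻¹ a(D) (1 + x⁻¹) b(D)` (`opA`), with `a = b = ζ(ζ-2)` for `Ã`, and
`a = ζ(ζ-2)(ζ-3)`, `b = ζ` for `Ǎ`. Each factor is inverted separately. Hardy's inequality inverts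
`D - c` for `c ≠ α`, if the norm is finite or if `c < α` and the function decays fast enough at `x =
0` (`exists_sob_le_shiftOps`). Multiplication by `1 + x⁻¹` turns one norm into two, with weights `α`
and `α + 1` (`exists_sob_le_oneAddInv_mul`).

Those two norms of a single function must be matched with the norms of two consecutive Taylor
remainders. A cutoff version of the monomial `a_J x^J` between them gives one function close to
both, with an error proportional to `|a_J|` (`exists_regularization`). This error is why
coefficients occur in `R_i`; conversely, the two remainders control `|a_J|` (`exists_abs_coef_le`).

Summing over the weights and iterating `m` times leaves the weighted norm of the iterated operator
minus a Taylor polynomial with exponents below `γ`. That polynomial vanishes if the norm without it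
is finite, since powers below `γ` are not integrable at `0` (`Expn.coef_eq_zero`), or if `γ < i +
1`: the first-order factors together with `w(0) = 0` kill the coefficients of index at most `i`, and
the operator preserves this. `exists_equivalence` assembles the argument. -/

/-- The algebra of smooth functions of the logarithmic variable `s = log x`. -/
def Sm : Subalgebra ℝ (ℝ → ℝ) where
  carrier := {f | ContDiff ℝ ∞ f}
  mul_mem' hf hg := ContDiff.mul (𝕜 := ℝ) (n := ∞) hf hg
  add_mem' hf hg := ContDiff.add (𝕜 := ℝ) (n := ∞) hf hg
  algebraMap_mem' r := contDiff_const (𝕜 := ℝ) (n := ∞) (c := r)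

namespace Sm

theorem contDiff (f : Sm) : ContDiff ℝ ∞ f.1 := f.2

theorem differentiable (f : Sm) : Differentiable ℝ f.1 := (contDiff f).differentiable (by simp)

theorem continuous (f : Sm) : Continuous f.1 := (contDiff f).continuous

@[simp] theorem add_val (f g : Sm) (s : ℝ) : (f + g).1 s = f.1 s + g.1 s := rfl
@[simp] theorem sub_val (f g : Sm) (s : ℝ) : (f - g).1 s = f.1 s - g.1 s := rfl
@[simp] theorem mul_val (f g : Sm) (s : ℝ) : (f * g).1 s = f.1 s * g.1 s := rfl
@[simp] theorem smul_val (c : ℝ) (f : Sm) (s : ℝ) : (c • f).1 s = c * f.1 s := rfl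
@[simp] theorem one_val (s : ℝ) : (1 : Sm).1 s = 1 := rfl
@[simp] theorem zero_val (s : ℝ) : (0 : Sm).1 s = 0 := rfl

theorem ext_val {f g : Sm} (h : ∀ s, f.1 s = g.1 s) : f = g := Subtype.ext (funext h)

end Sm

/-- The derivative `d/ds`, that is `x d/dx` in the variable `x = exp s`. -/
def der : Module.End ℝ Sm where
  toFun f := ⟨deriv f.1, (contDiff_infty_iff_deriv.1 f.2).2⟩
  map_add' f g := Sm.ext_val fun s =>
    deriv_add (Sm.differentiable f s) (Sm.differentiable g s)
  map_smul' c f := Sm.ext_val fun s => deriv_const_mul c (Sm.differentiable f s)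

theorem der_val (f : Sm) (s : ℝ) : (der f).1 s = deriv f.1 s := rfl

theorem hasDerivAt_val (f : Sm) (s : ℝ) : HasDerivAt f.1 ((der f).1 s) s :=
  (Sm.differentiable f s).hasDerivAt

theorem der_mul (f g : Sm) : der (f * g) = der f * g + f * der g :=
  Sm.ext_val fun s => deriv_mul (Sm.differentiable f s) (Sm.differentiable g s)

/-- The exponential `s ↦ exp (c s)`, that is the power `x ^ c`. -/
def expo (c : ℝ) : Sm := ⟨fun s => Real.exp (c * s), by
  show ContDiff ℝ ∞ _; fun_prop⟩

theorem expo_val (c s : ℝ) : (expo c).1 s = Real.exp (c * s) := rfl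

theorem der_expo (c : ℝ) : der (expo c) = c • expo c := Sm.ext_val fun s => by
  have h : HasDerivAt (fun s => Real.exp (c * s)) (Real.exp (c * s) * (c * 1)) s :=
    ((hasDerivAt_id s).const_mul c).exp
  rw [der_val, Sm.smul_val, expo_val]
  refine h.deriv.trans ?_
  ring

theorem expo_add (a b : ℝ) : expo (a + b) = expo a * expo b := Sm.ext_val fun s => by
  simp only [Sm.mul_val, expo_val, ← Real.exp_add, add_mul]

theorem expo_zero : expo 0 = 1 := Sm.ext_val fun s => by simp [expo_val]

theorem der_expo_mul (c : ℝ) (f : Sm) : der (expo c * f) = expo c * (der f + c • f) := by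
  rw [der_mul, der_expo, mul_add, mul_smul_comm, smul_mul_assoc, add_comm]

/-- The product `(D - c₁) ⋯ (D - cₙ)`. -/
def shiftOps : List ℝ → Module.End ℝ Sm
  | [] => 1
  | c :: l => (der - c • 1) * shiftOps l

/-- The characteristic polynomial `(t - c₁) ⋯ (t - cₙ)` of `shiftOps`. -/
def symb : List ℝ → ℝ → ℝ
  | [], _ => 1
  | c :: l, t => (t - c) * symb l t

@[simp] theorem shiftOps_nil (f : Sm) : shiftOps [] f = f := rfl

@[simp] theorem shiftOps_cons (c : ℝ) (l : List ℝ) (f : Sm) :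
    shiftOps (c :: l) f = der (shiftOps l f) - c • shiftOps l f := rfl

theorem shiftOps_expo (l : List ℝ) (t : ℝ) : shiftOps l (expo t) = symb l t • expo t := by
  induction l with
  | nil => simp [symb]
  | cons c l ih =>
    rw [shiftOps_cons, ih, map_smul, der_expo, symb, smul_smul, smul_smul, ← sub_smul]
    congr 1; ring

theorem symb_eq_zero {l : List ℝ} {t : ℝ} (h : t ∈ l) : symb l t = 0 := by
  induction l with
  | nil => simp at h
  | cons c l ih =>
    rcases List.mem_cons.1 h with rfl | h
    · simp [symb]
    · simp [symb, ih h]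

/-! ### Weighted norms -/

/-- The weighted `L²` norm `‖e^{-α s} f‖`. -/
def wt (α : ℝ) (f : Sm) : ℝ≥0∞ :=
  eLpNorm (fun s => Real.exp (-α * s) * f.1 s) 2 volume

/-- The weighted Sobolev norm `∑_{j ≤ k} ‖e^{-α s} f^{(j)}‖`. -/
def sob : ℕ → ℝ → Sm → ℝ≥0∞
  | 0, α, f => wt α f
  | k + 1, α, f => wt α f + sob k α (der f)

theorem continuous_wt (α : ℝ) (f : Sm) : Continuous fun s => Real.exp (-α * s) * f.1 s := by
  have := Sm.continuous f
  fun_prop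

theorem wt_add_le (α : ℝ) (f g : Sm) : wt α (f + g) ≤ wt α f + wt α g := by
  have h := eLpNorm_add_le (μ := volume) (p := 2)
    (continuous_wt α f).aestronglyMeasurable (continuous_wt α g).aestronglyMeasurable (by norm_num)
  refine le_trans (le_of_eq ?_) h
  unfold wt
  congr 1
  funext s
  simp [mul_add]

theorem wt_smul (α c : ℝ) (f : Sm) : wt α (c • f) = ENNReal.ofReal |c| * wt α f := by
  have h := eLpNorm_const_smul c (fun s => Real.exp (-α * s) * f.1 s) 2 (volume : Measure ℝ)
  unfold wt
  rw [← Real.enorm_eq_ofReal_abs, ← h]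
  congr 1
  funext s
  simp [mul_left_comm]

theorem wt_expo_mul (α c : ℝ) (f : Sm) : wt α (expo c * f) = wt (α - c) f := by
  unfold wt
  congr 1
  funext s
  rw [Sm.mul_val, expo_val, ← mul_assoc, ← Real.exp_add]
  congr 2; ring

theorem wt_le_sob (k : ℕ) (α : ℝ) (f : Sm) : wt α f ≤ sob k α f := by
  cases k with
  | zero => exact le_rfl
  | succ k => exact le_self_add

theorem sob_der_le (k : ℕ) (α : ℝ) (f : Sm) : sob k α (der f) ≤ sob (k + 1) α f :=
  le_add_self

theorem sob_add_le (k : ℕ) (α : ℝ) (f g : Sm) : sob k α (f + g) ≤ sob k α f + sob k α g := by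
  induction k generalizing f g with
  | zero => exact wt_add_le α f g
  | succ k ih =>
    simp only [sob, map_add]
    calc _ ≤ (wt α f + wt α g) + (sob k α (der f) + sob k α (der g)) :=
          add_le_add (wt_add_le α f g) (ih _ _)
      _ = _ := by ring

theorem sob_smul (k : ℕ) (α c : ℝ) (f : Sm) :
    sob k α (c • f) = ENNReal.ofReal |c| * sob k α f := by
  induction k generalizing f with
  | zero => exact wt_smul α c f
  | succ k ih => simp only [sob, map_smul, ih, wt_smul, mul_add]

theorem sob_sub_le (k : ℕ) (α : ℝ) (f g : Sm) : sob k α (f - g) ≤ sob k α f + sob k α g := by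
  have h := sob_add_le k α f ((-1 : ℝ) • g)
  rw [sob_smul] at h
  simpa [sub_eq_add_neg] using h

theorem sob_mono {k l : ℕ} (h : k ≤ l) (α : ℝ) (f : Sm) : sob k α f ≤ sob l α f := by
  induction h with
  | refl => exact le_rfl
  | @step l _ ih =>
    refine ih.trans ?_
    clear ih
    rename_i h
    clear h
    induction l generalizing f with
    | zero => exact le_self_add
    | succ l ih => exact add_le_add le_rfl (ih _)

theorem exists_sob_expo_mul_le (k : ℕ) (c : ℝ) : ∃ C : ℝ≥0, ∀ α f,
    sob k α (expo c * f) ≤ C * sob k (α - c) f := by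
  induction k with
  | zero => exact ⟨1, fun α f => by simpa [sob] using (wt_expo_mul α c f).le⟩
  | succ k ih =>
    obtain ⟨C, hC⟩ := ih
    refine ⟨1 + C * (1 + Real.nnabs c), fun α f => ?_⟩
    rw [sob, der_expo_mul, wt_expo_mul]
    calc wt (α - c) f + sob k α (expo c * (der f + c • f))
        ≤ sob (k + 1) (α - c) f + C * (sob k (α - c) (der f) + ENNReal.ofReal |c| *
            sob k (α - c) f) := by
          gcongr
          · exact wt_le_sob _ _ _
          · refine (hC _ _).trans ?_
            gcongr
            exact (sob_add_le _ _ _ _).trans_eq (by rw [sob_smul])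
      _ ≤ sob (k + 1) (α - c) f + C * (sob (k + 1) (α - c) f + ENNReal.ofReal |c| *
            sob (k + 1) (α - c) f) := by
          gcongr
          · exact sob_der_le _ _ _
          · exact sob_mono (Nat.le_succ k) _ _
      _ = _ := by
          have : ((Real.nnabs c : ℝ≥0) : ℝ≥0∞) = ENNReal.ofReal |c| := by
            rw [ENNReal.ofReal, ← Real.nnabs_of_nonneg (abs_nonneg c)]; simp
          push_cast
          rw [this]
          ring

theorem exists_sob_shiftOps_le (l : List ℝ) : ∃ C : ℝ≥0, ∀ k α f,
    sob k α (shiftOps l f) ≤ C * sob (k + l.length) α f := by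
  induction l with
  | nil => exact ⟨1, fun k α f => by simp⟩
  | cons c l ih =>
    obtain ⟨C, hC⟩ := ih
    refine ⟨C + ‖c‖₊ * C, fun k α f => ?_⟩
    have hc : ENNReal.ofReal |c| = ‖c‖₊ := by rw [← Real.enorm_eq_ofReal_abs]; rfl
    calc sob k α (shiftOps (c :: l) f)
        ≤ sob (k + 1) α (shiftOps l f) + ‖c‖₊ * sob (k + 1) α (shiftOps l f) := by
          refine (sob_sub_le _ _ _ _).trans ?_
          rw [LinearMap.smul_apply, Module.End.one_apply, sob_smul, hc]
          gcongr
          · exact sob_der_le _ _ _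
          · exact sob_mono (Nat.le_succ k) _ _
      _ ≤ C * sob (k + 1 + l.length) α f + ‖c‖₊ * (C * sob (k + 1 + l.length) α f) := by
          gcongr <;> exact hC _ _ _
      _ = _ := by
          rw [List.length_cons, add_assoc k 1, add_comm 1]
          push_cast; ring

/-! ### The factor `1 + x⁻¹` and two consecutive weights. -/

/-- Multiplication by `1 + x⁻¹`. -/
def oneAddInv : Sm := 1 + expo (-1)

theorem oneAddInv_mul (v : Sm) : oneAddInv * v = v + expo (-1) * v := by
  rw [oneAddInv, add_mul, one_mul]

theorem exists_sob_oneAddInv_mul_le (k : ℕ) : ∃ C : ℝ≥0, ∀ α v,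
    sob k α (oneAddInv * v) ≤ C * (sob k α v + sob k (α + 1) v) := by
  obtain ⟨C, hC⟩ := exists_sob_expo_mul_le k (-1)
  refine ⟨1 + C, fun α v => ?_⟩
  rw [oneAddInv_mul]
  calc _ ≤ sob k α v + C * sob k (α + 1) v := by
        refine (sob_add_le _ _ _ _).trans ?_
        gcongr
        simpa using hC α v
    _ ≤ (sob k α v + sob k (α + 1) v) + C * (sob k α v + sob k (α + 1) v) := by
        gcongr
        · exact le_self_add
        · exact le_add_self
    _ = _ := by push_cast; ring

theorem wt_le_of_abs_le {α : ℝ} {f : Sm} {β : ℝ} {g : Sm}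
    (h : ∀ s, |Real.exp (-α * s) * f.1 s| ≤ |Real.exp (-β * s) * g.1 s|) : wt α f ≤ wt β g :=
  eLpNorm_mono fun s => by simpa only [Real.norm_eq_abs] using h s

/-- Pointwise, `1 + x⁻¹` dominates both `1` and `x⁻¹`. For derivatives, commuting `D` past it costs
only `x⁻¹ v`, which is of lower order and already controlled. -/
theorem exists_sob_le_oneAddInv_mul (k : ℕ) (α : ℝ) : ∃ C : ℝ≥0, ∀ v,
    sob k α v + sob k (α + 1) v ≤ C * sob k α (oneAddInv * v) := by
  have base : ∀ v, wt α v ≤ wt α (oneAddInv * v) ∧ wt (α + 1) v ≤ wt α (oneAddInv * v) := by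
    intro v
    have key : ∀ s, (oneAddInv * v).1 s = (1 + Real.exp (-s)) * v.1 s := fun s => by
      rw [Sm.mul_val, oneAddInv, Sm.add_val, Sm.one_val, expo_val, neg_one_mul]
    constructor
    · refine wt_le_of_abs_le fun s => ?_
      rw [key, abs_mul, abs_mul, abs_mul, abs_of_pos (by positivity : 0 < 1 + Real.exp (-s))]
      gcongr
      exact le_mul_of_one_le_left (abs_nonneg _) (by linarith [Real.exp_pos (-s)])
    · refine wt_le_of_abs_le fun s => ?_
      rw [key, abs_mul, abs_mul, abs_mul, abs_of_pos (by positivity : 0 < 1 + Real.exp (-s)),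
        show -(α + 1) * s = -α * s + -s by ring, Real.exp_add, abs_mul, mul_assoc]
      gcongr
      rw [abs_of_pos (Real.exp_pos _)]
      linarith
  induction k with
  | zero =>
    refine ⟨2, fun v => ?_⟩
    simpa [sob, two_mul] using add_le_add (base v).1 (base v).2
  | succ k ih =>
    obtain ⟨C, hC⟩ := ih
    obtain ⟨C', hC'⟩ := exists_sob_expo_mul_le k (-1)
    refine ⟨2 + C * (1 + C' * C), fun v => ?_⟩
    set N := sob (k + 1) α (oneAddInv * v) with hN
    have h1 : oneAddInv * der v = der (oneAddInv * v) + expo (-1) * v := by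
      rw [oneAddInv_mul, oneAddInv_mul, map_add, der_expo_mul, mul_add, neg_one_smul]
      ring
    have h2 : sob k α (oneAddInv * der v) ≤ N + C' * (C * N) := by
      rw [h1]
      refine (sob_add_le _ _ _ _).trans ?_
      gcongr
      · exact sob_der_le _ _ _
      · refine (hC' α v).trans ?_
        gcongr
        rw [sub_neg_eq_add]
        refine le_add_self.trans ((hC v).trans ?_)
        gcongr
        exact sob_mono (Nat.le_succ k) _ _
    have h3 := hC (der v)
    simp only [sob]
    calc wt α v + sob k α (der v) + (wt (α + 1) v + sob k (α + 1) (der v))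
        = wt α v + wt (α + 1) v + (sob k α (der v) + sob k (α + 1) (der v)) := by ring
      _ ≤ N + N + C * (N + C' * (C * N)) := by
        gcongr
        · exact (base v).1.trans (wt_le_sob _ _ _)
        · exact (base v).2.trans (wt_le_sob _ _ _)
        · exact h3.trans (by gcongr)
      _ = _ := by push_cast; ring

/-! ### Hardy's inequality -/

theorem wt_eq_lintegral (α : ℝ) (f : Sm) :
    wt α f = (∫⁻ s, ENNReal.ofReal (Real.exp (-2 * α * s) * f.1 s ^ 2)) ^ (1 / 2 : ℝ) := by
  rw [wt, eLpNorm_eq_lintegral_rpow_enorm_toReal (by norm_num) (by norm_num)]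
  simp only [ENNReal.toReal_ofNat]
  congr 2
  funext s
  rw [Real.enorm_eq_ofReal_abs, ENNReal.ofReal_rpow_of_nonneg (abs_nonneg _) (by norm_num)]
  congr 1
  rw [show ((2 : ℝ)) = ((2 : ℕ) : ℝ) by norm_num, Real.rpow_natCast, sq_abs, mul_pow,
    ← Real.exp_nat_mul]
  congr 2
  push_cast; ring

/-- In the square of `g' + κ g` the cross term is the exact derivative `κ (g²)'`, and the term
`(g')²` is dropped. -/
theorem integral_sq_le (g : Sm) (κ : ℝ) {a b : ℝ} (hab : a ≤ b) :
    κ ^ 2 * ∫ s in a..b, g.1 s ^ 2 ≤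
      (∫ s in a..b, (der g + κ • g).1 s ^ 2) + (κ * g.1 a ^ 2 - κ * g.1 b ^ 2) := by
  have hg := Sm.continuous g
  have hg' := Sm.continuous (der g)
  have ftc : ∫ s in a..b, 2 * g.1 s * (der g).1 s = g.1 b ^ 2 - g.1 a ^ 2 := by
    refine intervalIntegral.integral_eq_sub_of_hasDerivAt (f := fun s => g.1 s ^ 2)
      (fun s _ => ?_) ?_
    · exact ((hasDerivAt_val g s).pow 2).congr_deriv (by simp)
    · exact Continuous.intervalIntegrable (by fun_prop) _ _
  have split : ∫ s in a..b, (der g + κ • g).1 s ^ 2 =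
      (∫ s in a..b, (der g).1 s ^ 2) + κ * (∫ s in a..b, 2 * g.1 s * (der g).1 s)
        + κ ^ 2 * ∫ s in a..b, g.1 s ^ 2 := by
    rw [← intervalIntegral.integral_const_mul, ← intervalIntegral.integral_const_mul,
      ← intervalIntegral.integral_add, ← intervalIntegral.integral_add]
    · congr 1
      funext s
      simp only [Sm.add_val, Sm.smul_val]
      ring
    all_goals exact Continuous.intervalIntegrable (by fun_prop) _ _
  have pos : 0 ≤ ∫ s in a..b, (der g).1 s ^ 2 :=
    intervalIntegral.integral_nonneg hab fun _ _ => sq_nonneg _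
  rw [split, ftc]
  linarith

theorem ofReal_integral_sq (g : Sm) {a b : ℝ} (hab : a ≤ b) :
    ENNReal.ofReal (∫ s in a..b, g.1 s ^ 2) =
      ∫⁻ s in Set.Ioc a b, ENNReal.ofReal (g.1 s ^ 2) := by
  have hg := Sm.continuous g
  rw [intervalIntegral.integral_of_le hab, ofReal_integral_eq_lintegral_ofReal]
  · exact (Continuous.integrableOn_Ioc (by fun_prop))
  · exact Eventually.of_forall fun _ => sq_nonneg _

/-- Only arbitrarily distant endpoints with small boundary term are required, so that it serves both
for finite norms and for one-sided decay. -/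
theorem wt_zero_le (g : Sm) {κ : ℝ} (hκ : κ ≠ 0)
    (h : ∀ ε > 0, ∀ T, ∃ a ≤ -T, ∃ b ≥ T, κ * g.1 a ^ 2 - κ * g.1 b ^ 2 ≤ ε) :
    wt 0 g ≤ ENNReal.ofReal |κ|⁻¹ * wt 0 (der g + κ • g) := by
  have hκ2 : 0 < κ ^ 2 := by positivity
  set I := ∫⁻ s, ENNReal.ofReal ((der g + κ • g).1 s ^ 2) with hI
  have bound : ∀ T : ℝ, ENNReal.ofReal (κ ^ 2) *
      ∫⁻ s in Set.Ioc (-T) T, ENNReal.ofReal (g.1 s ^ 2) ≤ I := by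
    intro T
    refine ENNReal.le_of_forall_pos_le_add fun ε hε _ => ?_
    obtain ⟨a, ha, b, hb, hab⟩ := h ε hε (max T 0)
    have ha' : a ≤ -T := ha.trans (by simp)
    have hb' : T ≤ b := (le_max_left _ _).trans hb
    have hab' : a ≤ b := ha.trans ((by simp : -max T 0 ≤ 0).trans ((le_max_right _ _).trans hb))
    calc _ ≤ ENNReal.ofReal (κ ^ 2) * ∫⁻ s in Set.Ioc a b, ENNReal.ofReal (g.1 s ^ 2) := by
          gcongr
      _ = ENNReal.ofReal (κ ^ 2 * ∫ s in a..b, g.1 s ^ 2) := by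
          rw [ENNReal.ofReal_mul hκ2.le, ofReal_integral_sq g hab']
      _ ≤ ENNReal.ofReal ((∫ s in a..b, (der g + κ • g).1 s ^ 2) + ε) :=
          ENNReal.ofReal_le_ofReal ((integral_sq_le g κ hab').trans (by linarith))
      _ ≤ ENNReal.ofReal (∫ s in a..b, (der g + κ • g).1 s ^ 2) + ε := by
          refine ENNReal.ofReal_add_le.trans ?_
          simp
      _ ≤ I + ε := by
          gcongr
          rw [ofReal_integral_sq _ hab']
          exact setLIntegral_le_lintegral _ _
  have total : ENNReal.ofReal (κ ^ 2) * ∫⁻ s, ENNReal.ofReal (g.1 s ^ 2) ≤ I := by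
    have hcov : AECover (volume : Measure ℝ) atTop fun T : ℝ => Set.Ioc (-T) T :=
      aecover_Ioc tendsto_neg_atTop_atBot tendsto_id
    have hm : Measurable fun s => ENNReal.ofReal (g.1 s ^ 2) := by
      have hg := Sm.continuous g
      have : Continuous fun s => g.1 s ^ 2 := by fun_prop
      exact this.measurable.ennreal_ofReal
    have lim := ENNReal.Tendsto.const_mul (a := ENNReal.ofReal (κ ^ 2))
      (hcov.lintegral_tendsto_of_countably_generated hm.aemeasurable)
      (Or.inr ENNReal.ofReal_ne_top)
    exact le_of_tendsto' lim bound
  have e : ∀ f : Sm, wt 0 f = (∫⁻ s, ENNReal.ofReal (f.1 s ^ 2)) ^ (1 / 2 : ℝ) := fun f => by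
    simp [wt_eq_lintegral]
  have hsq : ENNReal.ofReal (κ ^ 2) ^ (1 / 2 : ℝ) = ENNReal.ofReal |κ| := by
    rw [ENNReal.ofReal_rpow_of_nonneg (sq_nonneg _) (by norm_num), ← Real.sqrt_eq_rpow,
      Real.sqrt_sq_eq_abs]
  have main : ENNReal.ofReal |κ| * wt 0 g ≤ wt 0 (der g + κ • g) := by
    rw [e, e, ← hsq, ← ENNReal.mul_rpow_of_nonneg _ _ (by norm_num)]
    exact ENNReal.rpow_le_rpow total (by norm_num)
  have hpos : 0 < |κ| := abs_pos.2 hκ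
  calc wt 0 g = ENNReal.ofReal |κ|⁻¹ * (ENNReal.ofReal |κ| * wt 0 g) := by
        rw [← mul_assoc, ← ENNReal.ofReal_mul (by positivity), inv_mul_cancel₀ hpos.ne',
          ENNReal.ofReal_one, one_mul]
    _ ≤ _ := by gcongr

theorem volume_setOf_le_lt_top {g : Sm} (h : wt 0 g < ⊤) {ε : ℝ} (hε : 0 < ε) :
    volume {s | ε ≤ |g.1 s|} < ⊤ := by
  have hm : MemLp g.1 2 volume :=
    ⟨(Sm.continuous g).aestronglyMeasurable, by simpa [wt] using h⟩
  refine lt_of_le_of_lt (measure_mono fun s hs => ?_)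
    (hm.meas_ge_lt_top (ε := ε.toNNReal) (by norm_num) (by norm_num) (by simpa using hε))
  simpa [← NNReal.coe_le_coe, hε.le] using hs

theorem exists_le_abs_lt {g : Sm} (h : wt 0 g < ⊤) {ε : ℝ} (hε : 0 < ε) (T : ℝ) :
    ∃ a ≤ T, |g.1 a| < ε := by
  by_contra! hc
  have := (measure_mono (show Set.Iic T ⊆ _ from fun a ha => hc a ha)).trans_lt
    (volume_setOf_le_lt_top h hε)
  simp at this

theorem exists_ge_abs_lt {g : Sm} (h : wt 0 g < ⊤) {ε : ℝ} (hε : 0 < ε) (T : ℝ) :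
    ∃ a ≥ T, |g.1 a| < ε := by
  by_contra! hc
  have := (measure_mono (show Set.Ici T ⊆ _ from fun a ha => hc a ha)).trans_lt
    (volume_setOf_le_lt_top h hε)
  simp at this

/-- A square integrable function is small at points arbitrarily far out on both sides, which removes
the boundary terms whatever the sign of `α - c`. -/
theorem wt_le_of_wt_lt_top {α c : ℝ} (hc : c ≠ α) {f : Sm} (hf : wt α f < ⊤) :
    wt α f ≤ ENNReal.ofReal |α - c|⁻¹ * wt α (der f - c • f) := by
  have e : ∀ f, wt α f = wt 0 (expo (-α) * f) := fun f => by rw [wt_expo_mul]; simp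
  have e2 : expo (-α) * (der f - c • f) =
      der (expo (-α) * f) + (α - c) • (expo (-α) * f) := by
    rw [der_expo_mul, ← mul_smul_comm, ← mul_add]
    congr 1
    module
  rw [e f] at hf
  rw [e f, e, e2]
  refine wt_zero_le _ (sub_ne_zero.2 hc.symm) fun ε hε T => ?_
  set κ := α - c
  have hκ : 0 < |κ| := abs_pos.2 (sub_ne_zero.2 hc.symm)
  -- Since `δ ≤ 1`, `|x| < δ` gives `x² ≤ |x| ≤ ε / (2|κ|)`, so each boundary term is at most `ε /
  -- 2`.
  set δ := min 1 (ε / (2 * |κ|)) with hδ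
  have hδ0 : 0 < δ := by positivity
  obtain ⟨a, ha, hga⟩ := exists_le_abs_lt hf hδ0 (-T)
  obtain ⟨b, hb, hgb⟩ := exists_ge_abs_lt hf hδ0 T
  refine ⟨a, ha, b, hb, ?_⟩
  have sq : ∀ x : ℝ, |x| < δ → |κ * x ^ 2| ≤ ε / 2 := fun x hx => by
    rw [abs_mul, abs_pow]
    have h1 : |x| ^ 2 ≤ ε / (2 * |κ|) := by
      have : |x| ^ 2 ≤ |x| := by
        rw [pow_two]
        exact mul_le_of_le_one_left (abs_nonneg _) (hx.le.trans (min_le_left _ _))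
      exact this.trans (hx.le.trans (min_le_right _ _))
    calc |κ| * |x| ^ 2 ≤ |κ| * (ε / (2 * |κ|)) := by gcongr
      _ = ε / 2 := by field_simp
  have h1 := abs_le.1 (sq _ hga)
  have h2 := abs_le.1 (sq _ hgb)
  linarith [h1.2, h2.1]

/-- For `c < α` the boundary term at large `x` has the favourable sign, so decay at `x = 0` alone
suffices and the norm need not be known to be finite. -/
theorem wt_le_of_tendsto {α c : ℝ} (hc : c < α) {f : Sm}
    (hf : Tendsto (expo (-α) * f).1 atBot (𝓝 0)) :
    wt α f ≤ ENNReal.ofReal |α - c|⁻¹ * wt α (der f - c • f) := by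
  have e : ∀ f, wt α f = wt 0 (expo (-α) * f) := fun f => by rw [wt_expo_mul]; simp
  have e2 : expo (-α) * (der f - c • f) =
      der (expo (-α) * f) + (α - c) • (expo (-α) * f) := by
    rw [der_expo_mul, ← mul_smul_comm, ← mul_add]
    congr 1
    module
  rw [e f, e, e2]
  have hκ : 0 < α - c := sub_pos.2 hc
  refine wt_zero_le _ hκ.ne' fun ε hε T => ?_
  have lim : Tendsto (fun a => (α - c) * (expo (-α) * f).1 a ^ 2) atBot (𝓝 0) := by
    simpa using (hf.pow 2).const_mul (α - c)
  obtain ⟨a, ha, haT⟩ := ((lim.eventually (gt_mem_nhds hε)).and (eventually_le_atBot (-T))).exists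
  refine ⟨a, haT, T, le_rfl, ?_⟩
  have : 0 ≤ (α - c) * (expo (-α) * f).1 T ^ 2 := by positivity
  linarith

/-! ### Decay at `x = 0` -/

/-- `f` and all its derivatives are `O(x ^ σ)` as `x → 0`. -/
def Ord (σ : ℝ) (f : Sm) : Prop :=
  ∀ i : ℕ, ((der ^ i) f).1 =O[atBot] (expo σ).1

namespace Ord

variable {σ τ : ℝ} {f g : Sm}

theorem add (hf : Ord σ f) (hg : Ord σ g) : Ord σ (f + g) := fun i => by
  rw [map_add]
  exact (hf i).add (hg i)

theorem smul (c : ℝ) (hf : Ord σ f) : Ord σ (c • f) := fun i => by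
  rw [map_smul]
  exact (hf i).const_mul_left c

theorem sub (hf : Ord σ f) (hg : Ord σ g) : Ord σ (f - g) := by
  simpa [sub_eq_add_neg] using hf.add (hg.smul (-1))

theorem der (hf : Ord σ f) : Ord σ (der f) := fun i => by
  simpa [pow_succ] using hf (i + 1)

theorem mono (h : τ ≤ σ) (hf : Ord σ f) : Ord τ f := fun i => by
  refine (hf i).trans (IsBigO.of_bound 1 ?_)
  filter_upwards [eventually_le_atBot 0] with s hs
  rw [one_mul, expo_val, expo_val, Real.norm_of_nonneg (Real.exp_pos _).le,
    Real.norm_of_nonneg (Real.exp_pos _).le, Real.exp_le_exp]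
  exact mul_le_mul_of_nonpos_right h hs

theorem expo_mul (c : ℝ) (hf : Ord σ f) : Ord (σ + c) (expo c * f) := by
  intro i
  induction i generalizing f with
  | zero =>
    have := (isBigO_refl (expo c).1 atBot).mul (hf 0)
    rw [add_comm, expo_add]
    exact this
  | succ i ih =>
    rw [pow_succ, Module.End.mul_apply, der_expo_mul]
    exact ih (hf.der.add (hf.smul c))

theorem shiftOps (l : List ℝ) (hf : Ord σ f) : Ord σ (shiftOps l f) := by
  induction l with
  | nil => exact hf
  | cons c l ih => exact ih.der.sub (ih.smul c)

theorem tendsto {α : ℝ} (h : α < σ) (hf : Ord σ f) :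
    Tendsto (expo (-α) * f).1 atBot (𝓝 0) := by
  refine (hf.expo_mul (-α) 0).trans_tendsto ?_
  have : Tendsto (fun s : ℝ => (σ + -α) * s) atBot atBot :=
    tendsto_id.const_mul_atBot (by linarith)
  exact Real.tendsto_exp_atBot.comp this

end Ord

/-- Hardy's inequality applies to every derivative because `D` commutes with `D - c`; the extra
derivative is recovered from `D f = (D - c) f + c f`. -/
theorem exists_sob_succ_le (k : ℕ) {α c : ℝ} (hc : c ≠ α) : ∃ C : ℝ≥0, ∀ f,
    (sob k α f < ⊤ ∨ (c < α ∧ ∃ σ > α, Ord σ f)) →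
    sob (k + 1) α f ≤ C * sob k α (der f - c • f) := by
  have hardy : ∀ f, (wt α f < ⊤ ∨ (c < α ∧ ∃ σ > α, Ord σ f)) →
      wt α f ≤ ENNReal.ofReal |α - c|⁻¹ * wt α (der f - c • f) := by
    rintro f (hf | ⟨h, σ, hσ, hf⟩)
    · exact wt_le_of_wt_lt_top hc hf
    · exact wt_le_of_tendsto h (hf.tendsto hσ)
  have low : ∀ k f, (sob k α f < ⊤ ∨ (c < α ∧ ∃ σ > α, Ord σ f)) →
      sob k α f ≤ ENNReal.ofReal |α - c|⁻¹ * sob k α (der f - c • f) := by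
    intro k
    induction k with
    | zero => exact hardy
    | succ k ih =>
      intro f hf
      have h0 := hardy f (hf.imp_left fun h => (wt_le_sob _ _ _).trans_lt h)
      have h1 := ih (der f) (hf.imp (fun h => (sob_der_le _ _ _).trans_lt h)
        fun ⟨h, σ, hσ, ho⟩ => ⟨h, σ, hσ, ho.der⟩)
      simp only [sob, mul_add]
      refine add_le_add h0 (h1.trans_eq ?_)
      rw [map_sub, map_smul]
  set A : ℝ≥0 := (|α - c|⁻¹).toNNReal with hA
  refine ⟨A + (1 + ‖c‖₊ * A), fun f hf => ?_⟩
  have h := low k f hf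
  have hcc : ENNReal.ofReal |c| = ‖c‖₊ := by rw [← Real.enorm_eq_ofReal_abs]; rfl
  set N := sob k α (der f - c • f) with hN
  have h' : sob k α f ≤ A * N := h
  calc sob (k + 1) α f = wt α f + sob k α ((der f - c • f) + c • f) := by
        rw [sob, sub_add_cancel]
    _ ≤ A * N + (N + ‖c‖₊ * (A * N)) := by
        gcongr
        · exact (wt_le_sob k _ _).trans h'
        · refine (sob_add_le _ _ _ _).trans ?_
          rw [sob_smul, hcc]
          gcongr
    _ = _ := by push_cast; ring

theorem exists_sob_le_shiftOps (k : ℕ) {α : ℝ} {l : List ℝ} (hl : ∀ c ∈ l, c ≠ α) :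
    ∃ C : ℝ≥0, ∀ f, (sob (k + l.length) α f < ⊤ ∨ ((∀ c ∈ l, c < α) ∧ ∃ σ > α, Ord σ f)) →
      sob (k + l.length) α f ≤ C * sob k α (shiftOps l f) := by
  induction l generalizing k with
  | nil => exact ⟨1, fun f _ => by simp⟩
  | cons c l ih =>
    obtain ⟨C, hC⟩ := ih (k + 1) fun c hc => hl c (List.mem_cons_of_mem _ hc)
    obtain ⟨C', hC'⟩ := exists_sob_succ_le k (hl c List.mem_cons_self)
    obtain ⟨B, hB⟩ := exists_sob_shiftOps_le l
    refine ⟨C * C', fun f hf => ?_⟩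
    have len : k + (c :: l).length = k + 1 + l.length := by rw [List.length_cons]; omega
    rw [len] at hf ⊢
    have h1 := hC f (hf.imp_right fun ⟨h, h'⟩ => ⟨fun c hc => h c (List.mem_cons_of_mem _ hc), h'⟩)
    have h2 := hC' (shiftOps l f) (hf.imp
      (fun h => ((hB k α f).trans (mul_le_mul_right (sob_mono (by omega) _ _) _)).trans_lt
        (ENNReal.mul_lt_top ENNReal.coe_lt_top h))
      fun ⟨h, σ, hσ, ho⟩ => ⟨h c List.mem_cons_self, σ, hσ, ho.shiftOps l⟩)
    calc _ ≤ C * (C' * sob k α (shiftOps (c :: l) f)) := h1.trans (by gcongr; exact h2)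
      _ = _ := by push_cast; ring

/-! ### Expansions at `x = 0` -/

/-- The polynomial `∑_{j < J} a_j x ^ j`. -/
def tay (a : ℕ → ℝ) (J : ℕ) : Sm := ∑ j ∈ Finset.range J, a j • expo j

theorem tay_zero (a : ℕ → ℝ) : tay a 0 = 0 := rfl

theorem tay_succ (a : ℕ → ℝ) (J : ℕ) : tay a (J + 1) = tay a J + a J • expo J :=
  Finset.sum_range_succ _ _

theorem tay_eq_zero {a : ℕ → ℝ} {J : ℕ} (h : ∀ j < J, a j = 0) : tay a J = 0 :=
  Finset.sum_eq_zero fun j hj => by rw [h j (Finset.mem_range.1 hj), zero_smul]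

theorem shiftOps_tay (l : List ℝ) (a : ℕ → ℝ) (J : ℕ) :
    shiftOps l (tay a J) = tay (fun j => symb l j * a j) J := by
  simp only [tay, map_sum, map_smul, shiftOps_expo, smul_smul, mul_comm]

/-- `f` has the asymptotic expansion `∑ a_j x ^ j` at `x = 0`, with all its derivatives. -/
def Expn (f : Sm) (a : ℕ → ℝ) : Prop := ∀ J : ℕ, Ord J (f - tay a J)

namespace Expn

variable {f g : Sm} {a b : ℕ → ℝ}

theorem shiftOps (l : List ℝ) (hf : Expn f a) :
    Expn (shiftOps l f) fun j => symb l j * a j := fun J => by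
  rw [← shiftOps_tay, ← map_sub]
  exact (hf J).shiftOps l

theorem add (hf : Expn f a) (hg : Expn g b) : Expn (f + g) fun j => a j + b j := fun J => by
  have : f + g - tay (fun j => a j + b j) J = f - tay a J + (g - tay b J) := by
    simp only [tay, add_smul, Finset.sum_add_distrib]
    abel
  rw [this]
  exact (hf J).add (hg J)

theorem expo_neg_one_mul (hf : Expn f a) (h0 : a 0 = 0) :
    Expn (expo (-1) * f) fun j => a (j + 1) := fun J => by
  have : expo (-1) * f - tay (fun j => a (j + 1)) J = expo (-1) * (f - tay a (J + 1)) := by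
    rw [mul_sub]
    congr 1
    rw [tay, tay, Finset.sum_range_succ', h0, zero_smul, add_zero, Finset.mul_sum]
    refine Finset.sum_congr rfl fun j _ => ?_
    rw [mul_smul_comm, ← expo_add]
    congr 2
    push_cast; ring
  rw [this]
  simpa using (hf (J + 1)).expo_mul (-1)

theorem oneAddInv_mul (hf : Expn f a) (h0 : a 0 = 0) :
    Expn (oneAddInv * f) fun j => a j + a (j + 1) := by
  rw [ThinFilm.oneAddInv_mul]
  exact hf.add (hf.expo_neg_one_mul h0)

end Expn

/-! ### The factorized operator and its action on powers and expansions. -/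

/-- The operator `x⁻¹ a(D) (1 + x⁻¹) b(D)`. -/
def opA (la lb : List ℝ) : Module.End ℝ Sm :=
  LinearMap.mulLeft ℝ (expo (-1)) * shiftOps la * LinearMap.mulLeft ℝ oneAddInv * shiftOps lb

theorem opA_apply (la lb : List ℝ) (f : Sm) :
    opA la lb f = expo (-1) * shiftOps la (oneAddInv * shiftOps lb f) := rfl

/-- The action of `opA` on the coefficients of expansions. -/
def coefA (la lb : List ℝ) (a : ℕ → ℝ) : ℕ → ℝ := fun j =>
  symb la (j + 1) * (symb lb (j + 1) * a (j + 1) + symb lb (j + 2) * a (j + 2))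

/-- Neither division by `x` creates a pole: the inner one because `a 0 = 0`, the outer one because
the root `0` in `la` kills the constant term. -/
theorem Expn.opA {la lb : List ℝ} (h0 : (0 : ℝ) ∈ la) {f : Sm} {a : ℕ → ℝ} (hf : Expn f a)
    (ha : a 0 = 0) : Expn (opA la lb f) (coefA la lb a) := by
  have h := (((hf.shiftOps lb).oneAddInv_mul (by simp [ha])).shiftOps la).expo_neg_one_mul
    (by simp [symb_eq_zero h0])
  rw [opA_apply]
  convert h using 2 with j
  simp only [coefA]
  push_cast
  rw [add_assoc, one_add_one_eq_two]

theorem opA_expo (la lb : List ℝ) (t : ℝ) : opA la lb (expo t) =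
    (symb la t * symb lb t) • expo (t - 1) + (symb la (t - 1) * symb lb t) • expo (t - 2) := by
  rw [opA_apply, shiftOps_expo, mul_smul_comm, oneAddInv_mul, ← expo_add, map_smul, map_add,
    shiftOps_expo, shiftOps_expo, mul_smul_comm, mul_add, mul_smul_comm, mul_smul_comm,
    ← expo_add, ← expo_add, smul_add, smul_smul, smul_smul, mul_comm (symb lb t),
    mul_comm (symb lb t)]
  congr 3 <;> ring_nf

/-- The coefficient of `x^(J-2)` in the image expansion also involves `a J`, which is absent from
`tay a J`; the last term corrects for this. For `J ≤ 1` the correction vanishes. -/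
theorem opA_tay {la lb : List ℝ} (h0 : (0 : ℝ) ∈ la) {a : ℕ → ℝ} (ha : a 0 = 0) (J : ℕ) :
    opA la lb (tay a J) = tay (coefA la lb a) (J - 1)
      - (a J * (symb la (J - 1) * symb lb J)) • expo (J - 2) := by
  induction J with
  | zero => simp [tay_zero, ha]
  | succ J ih =>
    rw [tay_succ, map_add, map_smul, ih, opA_expo]
    cases J with
    | zero => simp [ha, symb_eq_zero h0, tay_zero]
    | succ J =>
      simp only [Nat.add_sub_cancel, tay_succ (coefA la lb a) J, coefA]
      push_cast
      rw [show (J : ℝ) + 1 - 1 = J by ring, show (J : ℝ) + 1 + 1 - 1 = J + 1 by ring,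
        show (J : ℝ) + 1 + 1 - 2 = J by ring, show (J : ℝ) + 1 + 1 = J + 2 by ring]
      module

/-! ### Estimates for the operator -/

theorem exists_sob_opA_le (la lb : List ℝ) (k : ℕ) : ∃ C : ℝ≥0, ∀ α V,
    sob k (α - 1) (opA la lb V) ≤
      C * (sob (k + la.length + lb.length) α V + sob (k + la.length + lb.length) (α + 1) V) := by
  obtain ⟨C₁, h₁⟩ := exists_sob_expo_mul_le k (-1)
  obtain ⟨C₂, h₂⟩ := exists_sob_shiftOps_le la
  obtain ⟨C₃, h₃⟩ := exists_sob_oneAddInv_mul_le (k + la.length)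
  obtain ⟨C₄, h₄⟩ := exists_sob_shiftOps_le lb
  refine ⟨C₁ * (C₂ * (C₃ * C₄)), fun α V => ?_⟩
  rw [opA_apply]
  have e : α - 1 - -1 = α := by ring
  calc _ ≤ C₁ * (C₂ * (C₃ * (C₄ * sob (k + la.length + lb.length) α V
        + C₄ * sob (k + la.length + lb.length) (α + 1) V))) := by
        refine (h₁ _ _).trans ?_
        rw [e]
        gcongr
        refine (h₂ _ _ _).trans ?_
        gcongr
        refine (h₃ _ _).trans ?_
        gcongr <;> exact h₄ _ _ _
    _ = _ := by push_cast; ring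

/-- The factors are inverted from the outside inwards: `x⁻¹` moves the weight to `α`, Hardy inverts
`la` there, `1 + x⁻¹` splits the norm, and Hardy inverts `lb` at both weights. The decay rate `σ +
1` leaves room for the inner `x⁻¹`. -/
theorem exists_sob_le_opA {la lb : List ℝ} (k : ℕ) {α : ℝ} (hla : ∀ c ∈ la, c ≠ α)
    (hlb : ∀ c ∈ lb, c ≠ α ∧ c ≠ α + 1) : ∃ C : ℝ≥0, ∀ V,
    ((sob (k + la.length + lb.length) α V < ⊤ ∧ sob (k + la.length + lb.length) (α + 1) V < ⊤) ∨
      ((∀ c ∈ la ++ lb, c < α) ∧ ∃ σ > α, Ord (σ + 1) V)) →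
    sob (k + la.length + lb.length) α V + sob (k + la.length + lb.length) (α + 1) V ≤
      C * sob k (α - 1) (opA la lb V) := by
  obtain ⟨C₁, h₁⟩ := exists_sob_expo_mul_le k 1
  obtain ⟨C₂, h₂⟩ := exists_sob_le_shiftOps k hla
  obtain ⟨C₃, h₃⟩ := exists_sob_le_oneAddInv_mul (k + la.length) α
  obtain ⟨C₄, h₄⟩ := exists_sob_le_shiftOps (k + la.length) fun c hc => (hlb c hc).1
  obtain ⟨C₅, h₅⟩ := exists_sob_le_shiftOps (k + la.length) fun c hc => (hlb c hc).2
  obtain ⟨B₁, g₁⟩ := exists_sob_oneAddInv_mul_le (k + la.length)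
  obtain ⟨B₂, g₂⟩ := exists_sob_shiftOps_le lb
  refine ⟨(C₄ + C₅) * (C₃ * (C₂ * C₁)), fun V hV => ?_⟩
  have i₄ := h₄ V (hV.imp And.left fun ⟨h, σ, hσ, ho⟩ =>
    ⟨fun c hc => h c (List.mem_append_right _ hc), σ, hσ, ho.mono (by linarith)⟩)
  have i₅ := h₅ V (hV.imp And.right fun ⟨h, σ, hσ, ho⟩ =>
    ⟨fun c hc => (h c (List.mem_append_right _ hc)).trans (by linarith), σ + 1, by linarith, ho⟩)
  have i₂ := h₂ (oneAddInv * shiftOps lb V) (hV.imp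
    (fun ⟨hα, hα'⟩ => by
      refine (g₁ α _).trans_lt (ENNReal.mul_lt_top ENNReal.coe_lt_top (ENNReal.add_lt_top.2 ⟨?_, ?_⟩))
      · exact (g₂ _ _ _).trans_lt (ENNReal.mul_lt_top ENNReal.coe_lt_top hα)
      · exact (g₂ _ _ _).trans_lt (ENNReal.mul_lt_top ENNReal.coe_lt_top hα'))
    fun ⟨h, σ, hσ, ho⟩ => ⟨fun c hc => h c (List.mem_append_left _ hc), σ, hσ, by
      have ho' := ho.shiftOps lb
      rw [oneAddInv_mul]
      refine (ho'.mono (by linarith)).add ?_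
      simpa using ho'.expo_mul (-1)⟩)
  have i₁ := h₁ α (opA la lb V)
  rw [opA_apply, show expo (-1) = expo (-(1 : ℝ)) from rfl] at i₁
  rw [← mul_assoc, ← expo_add, show (1 : ℝ) + -1 = 0 by ring, expo_zero, one_mul] at i₁
  rw [opA_apply]
  set v := shiftOps lb V with hv
  set N := sob k (α - 1) (expo (-1) * shiftOps la (oneAddInv * v)) with hN
  have j : sob (k + la.length) α v + sob (k + la.length) (α + 1) v ≤ C₃ * (C₂ * (C₁ * N)) := by
    refine (h₃ v).trans ?_
    gcongr
    refine i₂.trans ?_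
    gcongr
  calc _ ≤ C₄ * (C₃ * (C₂ * (C₁ * N))) + C₅ * (C₃ * (C₂ * (C₁ * N))) := by
        refine add_le_add (i₄.trans ?_) (i₅.trans ?_)
        · gcongr; exact le_self_add.trans j
        · gcongr; exact le_add_self.trans j
    _ = _ := by push_cast; ring

/-! ### Cutoff -/

/-- A smooth cutoff function, `1` for `s ≤ 0` and `0` for `s ≥ 1`. -/
def cut : Sm := ⟨fun s => 1 - Real.smoothTransition s, by
  have : ContDiff ℝ ∞ Real.smoothTransition := Real.smoothTransition.contDiff
  show ContDiff ℝ ∞ _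
  fun_prop⟩

theorem cut_of_nonpos {s : ℝ} (h : s ≤ 0) : cut.1 s = 1 := by
  simp [cut, Real.smoothTransition.zero_of_nonpos h]

theorem cut_of_one_le {s : ℝ} (h : 1 ≤ s) : cut.1 s = 0 := by
  simp [cut, Real.smoothTransition.one_of_one_le h]

theorem eqOn_der {f g : Sm} {U : Set ℝ} (hU : IsOpen U) (h : Set.EqOn f.1 g.1 U) :
    Set.EqOn (der f).1 (der g).1 U := fun _ hs =>
  (h.eventuallyEq_of_mem (hU.mem_nhds hs)).deriv_eq

theorem eqOn_shiftOps {f g : Sm} {U : Set ℝ} (hU : IsOpen U) (h : Set.EqOn f.1 g.1 U)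
    (l : List ℝ) : Set.EqOn (shiftOps l f).1 (shiftOps l g).1 U := by
  induction l with
  | nil => exact h
  | cons c l ih =>
    intro s hs
    simp only [shiftOps_cons, Sm.sub_val, Sm.smul_val, eqOn_der hU ih hs, ih hs]

theorem eqOn_opA {f g : Sm} {U : Set ℝ} (hU : IsOpen U) (h : Set.EqOn f.1 g.1 U)
    (la lb : List ℝ) : Set.EqOn (opA la lb f).1 (opA la lb g).1 U := by
  have h1 : Set.EqOn (oneAddInv * shiftOps lb f).1 (oneAddInv * shiftOps lb g).1 U :=
    fun _ hs => by simp only [Sm.mul_val, eqOn_shiftOps hU h lb hs]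
  intro s hs
  simp only [opA_apply, Sm.mul_val]
  rw [eqOn_shiftOps hU h1 la hs]

/-- Powers above `α` are integrable against the weight at `x = 0`, powers below `α` at infinity. -/
theorem wt_lt_top_of_eqOn {α ρ σ c₁ c₂ : ℝ} (hρ : α < ρ) (hσ : σ < α) {g : Sm}
    (h₁ : Set.EqOn g.1 (c₁ • expo ρ).1 (Set.Iio 0))
    (h₂ : Set.EqOn g.1 (c₂ • expo σ).1 (Set.Ioi 1)) : wt α g < ⊤ := by
  have hm := (continuous_wt α g)
  have hint : Integrable (fun s => (Real.exp (-α * s) * g.1 s) ^ 2) := by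
    refine (hm.pow 2).locallyIntegrable.integrable_of_isBigO_atBot_atTop
      (g := fun s => Real.exp ((2 * (ρ - α)) * s)) (g' := fun s => Real.exp ((2 * (σ - α)) * s))
      ?_ ?_ ?_ ?_
    · refine IsBigO.of_bound (c₁ ^ 2) ?_
      filter_upwards [eventually_lt_atBot 0] with s hs
      rw [h₁ hs, Sm.smul_val, expo_val, Real.norm_of_nonneg (by positivity),
        Real.norm_of_nonneg (by positivity), mul_left_comm, ← Real.exp_add, mul_pow,
        ← Real.exp_nat_mul]
      apply le_of_eq
      congr 2; push_cast; ring
    · exact ⟨Set.Iic 0, Iic_mem_atBot 0, integrableOn_exp_mul_Iic (by linarith) 0⟩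
    · refine IsBigO.of_bound (c₂ ^ 2) ?_
      filter_upwards [eventually_gt_atTop 1] with s hs
      rw [h₂ hs, Sm.smul_val, expo_val, Real.norm_of_nonneg (by positivity),
        Real.norm_of_nonneg (by positivity), mul_left_comm, ← Real.exp_add, mul_pow,
        ← Real.exp_nat_mul]
      apply le_of_eq
      congr 2; push_cast; ring
    · exact ⟨Set.Ioi 0, Ioi_mem_atTop 0, integrableOn_exp_mul_Ioi (by linarith) 0⟩
  exact ((memLp_two_iff_integrable_sq hm.aestronglyMeasurable).2 hint).2

theorem sob_lt_top_of_eqOn (k : ℕ) {α ρ σ : ℝ} (hρ : α < ρ) (hσ : σ < α) {c₁ c₂ : ℝ} {g : Sm}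
    (h₁ : Set.EqOn g.1 (c₁ • expo ρ).1 (Set.Iio 0))
    (h₂ : Set.EqOn g.1 (c₂ • expo σ).1 (Set.Ioi 1)) : sob k α g < ⊤ := by
  induction k generalizing g c₁ c₂ with
  | zero => exact wt_lt_top_of_eqOn hρ hσ h₁ h₂
  | succ k ih =>
    have e₁ := eqOn_der isOpen_Iio h₁
    have e₂ := eqOn_der isOpen_Ioi h₂
    rw [map_smul, der_expo, smul_smul] at e₁ e₂
    exact ENNReal.add_lt_top.2 ⟨wt_lt_top_of_eqOn hρ hσ h₁ h₂, ih e₁ e₂⟩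

/-- The monomial `a_J x^J` is the difference of the two remainders. On `0 ≤ s ≤ 1` the two weights
are comparable and `exp ((J - α) s) ≥ 1`. -/
theorem exists_abs_coef_le (k : ℕ) {α : ℝ} {J : ℕ} (hJ : α < J) : ∃ C : ℝ≥0, ∀ (u : Sm) a,
    ENNReal.ofReal |a J| ≤
      C * (sob k α (u - tay a J) + sob k (α + 1) (u - tay a (J + 1))) := by
  set μ := (volume : Measure ℝ).restrict (Set.Icc 0 1) with hμ
  have hμ1 : μ Set.univ = 1 := by simp [hμ]
  have hprob : IsProbabilityMeasure μ := ⟨hμ1⟩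
  refine ⟨1 + ‖Real.exp 1‖₊, fun u a => ?_⟩
  set p := u - tay a J with hp
  set q := u - tay a (J + 1) with hq
  have hpq : ∀ s, p.1 s - q.1 s = a J * Real.exp (J * s) := fun s => by
    have : p - q = a J • expo J := by rw [hp, hq, tay_succ]; abel
    rw [← Sm.sub_val, this, Sm.smul_val, expo_val]
  have step : ∀ᵐ s ∂μ, ‖a J‖ ≤ ‖Real.exp (-α * s) * p.1 s - Real.exp (-α * s) * q.1 s‖ := by
    refine (ae_restrict_mem measurableSet_Icc).mono fun s hs => ?_
    rw [← mul_sub, hpq, mul_left_comm, ← Real.exp_add, norm_mul,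
      Real.norm_of_nonneg (Real.exp_pos _).le]
    refine le_mul_of_one_le_right (norm_nonneg _) (Real.one_le_exp ?_)
    nlinarith [mul_nonneg hs.1 (sub_nonneg.2 hJ.le)]
  have stepq : ∀ᵐ s ∂μ, ‖Real.exp (-α * s) * q.1 s‖ ≤
      ‖Real.exp 1‖₊ * ‖Real.exp (-(α + 1) * s) * q.1 s‖ := by
    refine (ae_restrict_mem measurableSet_Icc).mono fun s hs => ?_
    rw [coe_nnnorm, norm_mul, norm_mul, ← mul_assoc]
    gcongr
    rw [← norm_mul, ← Real.exp_add, Real.norm_of_nonneg (Real.exp_pos _).le,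
      Real.norm_of_nonneg (Real.exp_pos _).le]
    exact Real.exp_le_exp.2 (by nlinarith [hs.2])
  have wt_p : eLpNorm (fun s => Real.exp (-α * s) * p.1 s) 2 μ ≤ sob k α p :=
    (eLpNorm_mono_measure _ Measure.restrict_le_self).trans (wt_le_sob _ _ _)
  have wt_q : eLpNorm (fun s => Real.exp (-(α + 1) * s) * q.1 s) 2 μ ≤ sob k (α + 1) q :=
    (eLpNorm_mono_measure _ Measure.restrict_le_self).trans (wt_le_sob _ _ _)
  have c_eq : ENNReal.ofReal |a J| = eLpNorm (fun _ : ℝ => a J) 2 μ := by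
    rw [eLpNorm_const _ (by norm_num) hprob.ne_zero, hμ1, Real.enorm_eq_ofReal_abs]
    simp
  calc ENNReal.ofReal |a J|
      ≤ eLpNorm (fun s => Real.exp (-α * s) * p.1 s) 2 μ
        + eLpNorm (fun s => Real.exp (-α * s) * q.1 s) 2 μ := by
        rw [c_eq]
        refine (eLpNorm_mono_ae step).trans ?_
        exact eLpNorm_sub_le (continuous_wt α p).aestronglyMeasurable
          (continuous_wt α q).aestronglyMeasurable (by norm_num)
    _ ≤ sob k α p + ‖Real.exp 1‖₊ * sob k (α + 1) q := by
        gcongr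
        refine (eLpNorm_le_nnreal_smul_eLpNorm_of_ae_le_mul stepq 2).trans ?_
        rw [ENNReal.smul_def, smul_eq_mul]
        gcongr
    _ ≤ (sob k α p + sob k (α + 1) q) +
          ‖Real.exp 1‖₊ * (sob k α p + sob k (α + 1) q) := by
        gcongr
        · exact le_self_add
        · exact le_add_self
    _ = _ := by push_cast; ring

/-! ### One application of the operator -/

theorem sob_le_add_of_eq {k : ℕ} {α c : ℝ} {p q g : Sm} {B : ℝ≥0∞} (h : p = q + c • g)
    (hB : sob k α g ≤ B) :
    sob k α p ≤ sob k α q + ENNReal.ofReal |c| * B ∧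
      sob k α q ≤ sob k α p + ENNReal.ofReal |c| * B := by
  have h' : q = p + (-c) • g := by rw [h]; module
  constructor
  · calc sob k α p ≤ sob k α q + sob k α (c • g) := h ▸ sob_add_le _ _ _ _
      _ ≤ _ := by rw [sob_smul]; gcongr
  · calc sob k α q ≤ sob k α p + sob k α ((-c) • g) := by
          conv_lhs => rw [h']
          exact sob_add_le _ _ _ _
      _ ≤ _ := by rw [sob_smul, abs_neg]; gcongr

/-- A regularization `V` of the remainders `u - tay a J` and `u - tay a (J + 1)` which is
controlled in both weighted norms. -/
theorem exists_regularization {la lb : List ℝ} (h0 : (0 : ℝ) ∈ la) (k N : ℕ) {α : ℝ} {J : ℕ}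
    (hJ₁ : (J : ℝ) - 1 < α) (hJ₂ : α < J) : ∃ B : ℝ≥0, ∀ (u : Sm) (a : ℕ → ℝ), a 0 = 0 →
    ∃ V : Sm, (Expn u a → Ord (J + 1) V) ∧
      (sob N α (u - tay a J) ≤ sob N α V + ENNReal.ofReal |a J| * B ∧
        sob N α V ≤ sob N α (u - tay a J) + ENNReal.ofReal |a J| * B) ∧
      (sob N (α + 1) (u - tay a (J + 1)) ≤ sob N (α + 1) V + ENNReal.ofReal |a J| * B ∧
        sob N (α + 1) V ≤ sob N (α + 1) (u - tay a (J + 1)) + ENNReal.ofReal |a J| * B) ∧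
      (sob k (α - 1) (opA la lb u - tay (coefA la lb a) (J - 1)) ≤
          sob k (α - 1) (opA la lb V) + ENNReal.ofReal |a J| * B ∧
        sob k (α - 1) (opA la lb V) ≤
          sob k (α - 1) (opA la lb u - tay (coefA la lb a) (J - 1))
            + ENNReal.ofReal |a J| * B) := by
  set θ := symb la (J - 1) * symb lb J with hθ
  set g₁ := cut * expo J with hg₁
  set g₂ := (1 - cut) * expo J with hg₂
  -- `a J • G` is the defect between the image of the regularization and the remainder of `opA la lb
  -- u`. Near `x = 0` the power `x^(J-2)` cancels, leaving a multiple of `x^(J-1)`; for large `x`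
  -- only `θ x^(J-2)` survives. The norm is finite as `J - 2 < α - 1 < J - 1`.
  set G := θ • expo (J - 2) - opA la lb g₁ with hG
  have cut_left : Set.EqOn g₁.1 (expo J).1 (Set.Iio 0) := fun s hs => by
    rw [hg₁, Sm.mul_val, cut_of_nonpos (le_of_lt hs), one_mul]
  have cut_right : Set.EqOn g₁.1 (0 : Sm).1 (Set.Ioi 1) := fun s hs => by
    rw [hg₁, Sm.mul_val, cut_of_one_le (le_of_lt hs), zero_mul]; rfl
  have cut_left' : Set.EqOn g₂.1 (0 : Sm).1 (Set.Iio 0) := fun s hs => by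
    rw [hg₂, Sm.mul_val, Sm.sub_val, cut_of_nonpos (le_of_lt hs), Sm.one_val, sub_self, zero_mul]
    rfl
  have cut_right' : Set.EqOn g₂.1 (expo J).1 (Set.Ioi 1) := fun s hs => by
    rw [hg₂, Sm.mul_val, Sm.sub_val, cut_of_one_le (le_of_lt hs), Sm.one_val, sub_zero, one_mul]
  have b₁ : sob N α g₁ < ⊤ := by
    refine sob_lt_top_of_eqOn N (ρ := J) (σ := α - 1) (c₁ := 1) (c₂ := 0) hJ₂ (by linarith) ?_ ?_
    · rwa [one_smul]
    · rwa [zero_smul]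
  have b₂ : sob N (α + 1) g₂ < ⊤ := by
    refine sob_lt_top_of_eqOn N (ρ := α + 2) (σ := J) (c₁ := 0) (c₂ := 1) (by linarith)
      (by linarith) ?_ ?_
    · rwa [zero_smul]
    · rwa [one_smul]
  have b₃ : sob k (α - 1) G < ⊤ := by
    refine sob_lt_top_of_eqOn k (ρ := J - 1) (σ := J - 2) (c₁ := -(symb la J * symb lb J))
      (c₂ := θ) (by linarith) (by linarith) ?_ ?_
    · intro s hs
      have e := eqOn_opA isOpen_Iio cut_left la lb hs
      rw [opA_expo] at e
      simp only [hG, Sm.sub_val, e, Sm.add_val, Sm.smul_val, hθ]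
      ring
    · intro s hs
      have e := eqOn_opA isOpen_Ioi cut_right la lb hs
      rw [map_zero, Sm.zero_val] at e
      rw [hG, Sm.sub_val, e, sub_zero]
  set B := max (sob N α g₁) (max (sob N (α + 1) g₂) (sob k (α - 1) G)) with hB
  have hBtop : B < ⊤ := max_lt b₁ (max_lt b₂ b₃)
  refine ⟨B.toNNReal, fun u a ha => ?_⟩
  rw [ENNReal.coe_toNNReal hBtop.ne]
  -- This function is the longer remainder near `x = 0` and the shorter one for large `x`. It
  -- differs from them by multiples of `g₂` and `g₁`, whose norms are finite because `α < J < α +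
  -- 1`.
  refine ⟨u - tay a J - a J • g₁, fun hu => ?_, ?_, ?_, ?_⟩
  · have e : u - tay a J - a J • g₁ = u - tay a (J + 1) + a J • g₂ := by
      rw [tay_succ, hg₁, hg₂, sub_mul, one_mul]; module
    rw [e]
    have h := hu (J + 1)
    push_cast at h
    refine h.add (Ord.smul _ fun i => ?_)
    have hi : ∀ i, Set.EqOn ((der ^ i) g₂).1 (0 : Sm).1 (Set.Iio 0) := fun i => by
      induction i with
      | zero => exact cut_left'
      | succ i ih =>
        rw [pow_succ', Module.End.mul_apply]
        simpa using eqOn_der isOpen_Iio ih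
    have ev : ((der ^ i) g₂).1 =ᶠ[atBot] (0 : Sm).1 :=
      (eventually_lt_atBot 0).mono fun _ hs => hi i hs
    exact ev.trans_isBigO (isBigO_zero _ _)
  · exact sob_le_add_of_eq (c := a J) (g := g₁) (by module) (le_max_left _ _)
  · have h := sob_le_add_of_eq (k := N) (α := α + 1) (c := a J) (g := g₂)
      (p := u - tay a J - a J • g₁) (q := u - tay a (J + 1)) (B := B)
      (by rw [tay_succ, hg₁, hg₂, sub_mul, one_mul]; module)
      ((le_max_left _ _).trans (le_max_right _ _))
    exact h.symm
  · have h := sob_le_add_of_eq (k := k) (α := α - 1) (c := a J) (g := G)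
      (p := opA la lb (u - tay a J - a J • g₁))
      (q := opA la lb u - tay (coefA la lb a) (J - 1)) (B := B)
      (by rw [map_sub, map_sub, map_smul, opA_tay h0 ha, hG]; module)
      ((le_max_right _ _).trans (le_max_right _ _))
    exact h.symm

/-- The operator bound is applied to the regularization; the errors `|a J|` are absorbed by
`exists_abs_coef_le`. -/
theorem exists_step_le {la lb : List ℝ} (h0 : (0 : ℝ) ∈ la) (k : ℕ) {α : ℝ} {J : ℕ}
    (hJ₁ : (J : ℝ) - 1 < α) (hJ₂ : α < J) : ∃ C : ℝ≥0, ∀ (u : Sm) (a : ℕ → ℝ), a 0 = 0 →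
    sob k (α - 1) (opA la lb u - tay (coefA la lb a) (J - 1)) + ENNReal.ofReal |a J| ≤
      C * (sob (k + la.length + lb.length) α (u - tay a J)
        + sob (k + la.length + lb.length) (α + 1) (u - tay a (J + 1))) := by
  obtain ⟨B, hB⟩ := exists_regularization (lb := lb) h0 k (k + la.length + lb.length) hJ₁ hJ₂
  obtain ⟨C₀, h₀⟩ := exists_abs_coef_le (k + la.length + lb.length) hJ₂
  obtain ⟨C₁, h₁⟩ := exists_sob_opA_le la lb k
  refine ⟨C₁ * (1 + C₀ * B + C₀ * B) + C₀ * B + C₀, fun u a ha => ?_⟩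
  obtain ⟨V, -, ⟨-, v₁⟩, ⟨-, v₂⟩, ⟨v₃, -⟩⟩ := hB u a ha
  have c := h₀ u a
  set X₁ := sob (k + la.length + lb.length) α (u - tay a J)
  set X₂ := sob (k + la.length + lb.length) (α + 1) (u - tay a (J + 1))
  calc _ ≤ C₁ * ((X₁ + C₀ * (X₁ + X₂) * B) + (X₂ + C₀ * (X₁ + X₂) * B))
        + C₀ * (X₁ + X₂) * B + C₀ * (X₁ + X₂) := by
        gcongr
        refine v₃.trans ?_
        gcongr
        refine (h₁ _ _).trans ?_
        gcongr
        · refine v₁.trans ?_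
          gcongr
        · refine v₂.trans ?_
          gcongr
    _ = _ := by push_cast; ring

/-- Here the regularization error cannot be absorbed and stays on the right as `|a J|`. Without
finiteness, the regularization's decay of order `J + 1 > α + 1` at `x = 0` justifies Hardy's
inequality. -/
theorem exists_le_step {la lb : List ℝ} (h0 : (0 : ℝ) ∈ la) (k : ℕ) {α : ℝ} {J : ℕ}
    (hJ₁ : (J : ℝ) - 1 < α) (hJ₂ : α < J) (hne : ∀ c ∈ la ++ lb, c ≠ α ∧ c ≠ α + 1) :
    ∃ C : ℝ≥0, ∀ (u : Sm) (a : ℕ → ℝ), Expn u a → a 0 = 0 →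
    (sob (k + la.length + lb.length) α (u - tay a J)
        + sob (k + la.length + lb.length) (α + 1) (u - tay a (J + 1)) < ⊤ ∨
      ∀ c ∈ la ++ lb, c < α) →
    sob (k + la.length + lb.length) α (u - tay a J)
        + sob (k + la.length + lb.length) (α + 1) (u - tay a (J + 1)) ≤
      C * (sob k (α - 1) (opA la lb u - tay (coefA la lb a) (J - 1))
        + ENNReal.ofReal |a J|) := by
  obtain ⟨B, hB⟩ := exists_regularization (lb := lb) h0 k (k + la.length + lb.length) hJ₁ hJ₂
  obtain ⟨C₁, h₁⟩ := exists_sob_le_opA k (fun c hc => (hne c (List.mem_append_left _ hc)).1)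
    (fun c hc => hne c (List.mem_append_right la hc))
  refine ⟨C₁ * (1 + B) + B + B, fun u a hu ha hX => ?_⟩
  obtain ⟨V, ho, ⟨u₁, v₁⟩, ⟨u₂, v₂⟩, ⟨-, v₃⟩⟩ := hB u a ha
  have hfin : ENNReal.ofReal |a J| * B < ⊤ :=
    ENNReal.mul_lt_top ENNReal.ofReal_lt_top ENNReal.coe_lt_top
  have key := h₁ V (hX.imp
    (fun h => by
      have h' := ENNReal.add_lt_top.1 h
      exact ⟨v₁.trans_lt (ENNReal.add_lt_top.2 ⟨h'.1, hfin⟩),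
        v₂.trans_lt (ENNReal.add_lt_top.2 ⟨h'.2, hfin⟩)⟩)
    fun h => ⟨h, J, hJ₂, ho hu⟩)
  set c := ENNReal.ofReal |a J|
  set F := sob k (α - 1) (opA la lb u - tay (coefA la lb a) (J - 1))
  calc _ ≤ (sob (k + la.length + lb.length) α V + c * B)
        + (sob (k + la.length + lb.length) (α + 1) V + c * B) := add_le_add u₁ u₂
    _ = (sob (k + la.length + lb.length) α V
        + sob (k + la.length + lb.length) (α + 1) V) + (c * B + c * B) := by ring
    _ ≤ C₁ * (F + c * B) + (c * B + c * B) := by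
        gcongr
        refine key.trans ?_
        gcongr
    _ ≤ C₁ * ((F + c) + (F + c) * B) + ((F + c) * B + (F + c) * B) := by
        gcongr <;> first | exact le_self_add | exact le_add_self
    _ = _ := by push_cast; ring

/-! ### Iteration -/

theorem ceil_bounds {x : ℝ} (h : -1 < x) (hx : ∀ n : ℤ, x ≠ n) :
    (⌈x⌉₊ : ℝ) - 1 < x ∧ x < ⌈x⌉₊ := by
  constructor
  · rcases le_or_gt 0 x with h' | h'
    · linarith [Nat.ceil_lt_add_one h']
    · rw [Nat.ceil_eq_zero.2 h'.le]; simpa using h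
  · exact lt_of_le_of_ne (Nat.le_ceil x) fun e => hx ⌈x⌉₊ (by exact_mod_cast e)

/-- The truncated ceiling still advances by one on `-1 < x < 0`. This is where `γ > -2` enters: it
gives `γ + (m + 1) + r > -1`. -/
theorem ceil_add_one {x : ℝ} (h : -1 < x) : ⌈x + 1⌉₊ = ⌈x⌉₊ + 1 := by
  rcases le_or_gt 0 x with h' | h'
  · exact Nat.ceil_add_one h'
  · rw [Nat.ceil_eq_zero.2 h'.le, zero_add, Nat.ceil_eq_iff one_ne_zero]
    constructor <;> norm_num <;> linarith

theorem ceil_sub_one (x : ℝ) : ⌈x - 1⌉₊ = ⌈x⌉₊ - 1 := by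
  rcases le_or_gt x 0 with h' | h'
  · rw [Nat.ceil_eq_zero.2 h', Nat.ceil_eq_zero.2 (by linarith)]
  · have := ceil_add_one (x := x - 1) (by linarith)
    rw [sub_add_cancel] at this
    omega

/-- The sum of the weighted norms of the remainders. -/
def lowSum (K m : ℕ) (γ : ℝ) (u : Sm) (a : ℕ → ℝ) : ℝ≥0∞ :=
  ∑ r ∈ Finset.range (m + 1), sob K (γ + m + r) (u - tay a ⌈γ + m + r⌉₊)

/-- The sum of the moduli of the coefficients. -/
def coefSum (m : ℕ) (γ : ℝ) (a : ℕ → ℝ) : ℝ≥0∞ :=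
  ∑ r ∈ Finset.range m, ENNReal.ofReal |a ⌈γ + m + r⌉₊|

theorem exists_sum_le (n : ℕ) {ι : Type*} (P : ι → ℕ → Prop) (F G : ι → ℕ → ℝ≥0∞)
    (h : ∀ r < n, ∃ C : ℝ≥0, ∀ i, P i r → F i r ≤ C * G i r) :
    ∃ C : ℝ≥0, ∀ i, (∀ r < n, P i r) →
      ∑ r ∈ Finset.range n, F i r ≤ C * ∑ r ∈ Finset.range n, G i r := by
  induction n with
  | zero => exact ⟨0, fun i _ => by simp⟩
  | succ n ih =>
    obtain ⟨C, hC⟩ := ih fun r hr => h r (by omega)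
    obtain ⟨C', hC'⟩ := h n (by omega)
    refine ⟨C + C', fun i hi => ?_⟩
    rw [Finset.sum_range_succ, Finset.sum_range_succ]
    calc _ ≤ C * ∑ r ∈ Finset.range n, G i r + C' * G i n :=
          add_le_add (hC i fun r hr => hi r (by omega)) (hC' i (hi n (by omega)))
      _ ≤ (C + C') * ∑ r ∈ Finset.range n, G i r + (C + C') * G i n := by
          gcongr
          · exact le_self_add
          · exact le_add_self
      _ = _ := by push_cast; ring

theorem sum_pairs_le (t : ℕ → ℝ≥0∞) (m : ℕ) :
    ∑ r ∈ Finset.range (m + 1), (t r + t (r + 1)) ≤ 2 * ∑ r ∈ Finset.range (m + 2), t r := by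
  rw [Finset.sum_add_distrib, two_mul]
  gcongr
  · omega
  · rw [Finset.sum_range_succ' t (m + 1)]
    exact le_self_add

theorem le_sum_pairs (t : ℕ → ℝ≥0∞) (m : ℕ) :
    ∑ r ∈ Finset.range (m + 2), t r ≤ ∑ r ∈ Finset.range (m + 1), (t r + t (r + 1)) := by
  rw [Finset.sum_add_distrib, Finset.sum_range_succ]
  gcongr
  exact Finset.single_le_sum (f := fun r => t (r + 1)) (fun _ _ => zero_le) (by simp)

section Iterate

variable {la lb : List ℝ} {γ : ℝ}

/-- The new coefficient at `j` involves only the old ones at `j + 1` and `j + 2`, and these indices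
lie in the range belonging to `m + 1`. -/
theorem exists_coefSum_coefA_le (la lb : List ℝ) (hγ : -2 < γ) (m : ℕ) : ∃ C : ℝ≥0, ∀ a,
    coefSum m γ (coefA la lb a) ≤ C * coefSum (m + 1) γ a := by
  have h : ∀ r < m, ∃ C : ℝ≥0, ∀ a : ℕ → ℝ, True →
      ENNReal.ofReal |coefA la lb a ⌈γ + m + r⌉₊| ≤
        C * (ENNReal.ofReal |a ⌈γ + (m + 1 : ℕ) + r⌉₊|
          + ENNReal.ofReal |a ⌈γ + (m + 1 : ℕ) + (r + 1 : ℕ)⌉₊|) := by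
    intro r hr
    have hm : (1 : ℝ) ≤ m := by exact_mod_cast (by omega : 1 ≤ m)
    have hr0 : (0 : ℝ) ≤ r := r.cast_nonneg
    have e₁ : ⌈γ + (m + 1 : ℕ) + r⌉₊ = ⌈γ + m + r⌉₊ + 1 := by
      rw [← ceil_add_one (by linarith)]; congr 1; push_cast; ring
    have e₂ : ⌈γ + (m + 1 : ℕ) + (r + 1 : ℕ)⌉₊ = ⌈γ + m + r⌉₊ + 2 := by
      rw [show γ + (m + 1 : ℕ) + (r + 1 : ℕ) = γ + m + r + 1 + 1 by push_cast; ring,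
        ceil_add_one (by linarith), ceil_add_one (by linarith)]
    set j := ⌈γ + m + r⌉₊
    set p := symb la (j + 1) * symb lb (j + 1)
    set q := symb la (j + 1) * symb lb (j + 2)
    refine ⟨(max |p| |q|).toNNReal, fun a _ => ?_⟩
    rw [e₁, e₂, ← ENNReal.ofReal_add (abs_nonneg _) (abs_nonneg _)]
    change _ ≤ ENNReal.ofReal (max |p| |q|) * _
    rw [← ENNReal.ofReal_mul (by positivity)]
    refine ENNReal.ofReal_le_ofReal ?_
    have : coefA la lb a j = p * a (j + 1) + q * a (j + 2) := by simp only [coefA, p, q]; ring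
    rw [this]
    refine (abs_add_le _ _).trans ?_
    rw [abs_mul p, abs_mul q, mul_add]
    exact add_le_add (mul_le_mul_of_nonneg_right (le_max_left _ _) (abs_nonneg _))
      (mul_le_mul_of_nonneg_right (le_max_right _ _) (abs_nonneg _))
  obtain ⟨C, hC⟩ := exists_sum_le m (fun _ _ => True) _ _ h
  refine ⟨C * 2, fun a => (hC a fun _ _ => trivial).trans ?_⟩
  cases m with
  | zero => simp
  | succ m =>
    push_cast
    rw [mul_assoc]
    gcongr
    simpa [coefSum] using sum_pairs_le (fun r => ENNReal.ofReal |a ⌈γ + (m + 1 + 1 : ℕ) + r⌉₊|) m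

theorem pair_eq (hγ : -2 < γ) (N m r : ℕ) (u : Sm) (a : ℕ → ℝ) :
    sob N (γ + (m + 1 : ℕ) + r + 1) (u - tay a (⌈γ + (m + 1 : ℕ) + r⌉₊ + 1)) =
      sob N (γ + (m + 1 : ℕ) + (r + 1 : ℕ)) (u - tay a ⌈γ + (m + 1 : ℕ) + (r + 1 : ℕ)⌉₊) := by
  have hr0 : (0 : ℝ) ≤ r := r.cast_nonneg
  have hm0 : (0 : ℝ) ≤ m := m.cast_nonneg
  rw [← ceil_add_one (by push_cast; linarith)]
  push_cast
  rw [← add_assoc (γ + (m + 1 : ℝ)) (r : ℝ) 1]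

theorem lowSum_opA (K m : ℕ) (u : Sm) (a : ℕ → ℝ) :
    lowSum K m γ (opA la lb u) (coefA la lb a) + coefSum (m + 1) γ a =
      ∑ r ∈ Finset.range (m + 1), (sob K (γ + (m + 1 : ℕ) + r - 1)
          (opA la lb u - tay (coefA la lb a) (⌈γ + (m + 1 : ℕ) + r⌉₊ - 1))
        + ENNReal.ofReal |a ⌈γ + (m + 1 : ℕ) + r⌉₊|) := by
  rw [Finset.sum_add_distrib]
  congr 1
  refine Finset.sum_congr rfl fun r _ => ?_
  rw [← ceil_sub_one,
    show γ + (m + 1 : ℕ) + r - 1 = γ + m + r by push_cast; ring]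

theorem index_bounds (hγ : -2 < γ) (hγZ : ∀ n : ℤ, γ ≠ n) (m r : ℕ) :
    (⌈γ + (m + 1 : ℕ) + r⌉₊ : ℝ) - 1 < γ + (m + 1 : ℕ) + r ∧
      γ + (m + 1 : ℕ) + r < ⌈γ + (m + 1 : ℕ) + r⌉₊ := by
  refine ceil_bounds ?_ fun n hn => hγZ (n - (m + 1 : ℕ) - r) ?_
  · have hr0 : (0 : ℝ) ≤ r := r.cast_nonneg
    have hm0 : (0 : ℝ) ≤ m := m.cast_nonneg
    push_cast; linarith
  · push_cast at hn ⊢; linarith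

theorem exists_lowSum_opA_le (hlen : la.length + lb.length = 4) (h0 : (0 : ℝ) ∈ la)
    (hγ : -2 < γ) (hγZ : ∀ n : ℤ, γ ≠ n) (K m : ℕ) : ∃ C : ℝ≥0, ∀ (u : Sm) a, a 0 = 0 →
    lowSum K m γ (opA la lb u) (coefA la lb a) + coefSum (m + 1) γ a ≤
      C * lowSum (K + 4) (m + 1) γ u a := by
  obtain ⟨C, hC⟩ := exists_sum_le (m + 1) (ι := Sm × (ℕ → ℝ)) (fun i _ => i.2 0 = 0) _ _
    fun r _ => (exists_step_le (lb := lb) h0 K (index_bounds hγ hγZ m r).1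
      (index_bounds hγ hγZ m r).2).imp fun C hC (i : Sm × (ℕ → ℝ)) hi => hC i.1 i.2 hi
  refine ⟨C * 2, fun u a ha => ?_⟩
  rw [lowSum_opA]
  refine (hC (u, a) fun _ _ => ha).trans ?_
  rw [add_assoc K, hlen]
  push_cast
  rw [mul_assoc]
  gcongr
  have := sum_pairs_le (fun r => sob (K + 4) (γ + (m + 1 : ℕ) + r)
    (u - tay a ⌈γ + (m + 1 : ℕ) + r⌉₊)) m
  simp only [← pair_eq hγ] at this
  push_cast at this
  exact this.trans_eq (by simp [lowSum])

theorem exists_lowSum_le_opA {ν : ℕ} (hlen : la.length + lb.length = 4) (h0 : (0 : ℝ) ∈ la)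
    (hroots : ∀ c ∈ la ++ lb, ∃ n : ℕ, c = n ∧ n ≤ ν)
    (hγ : -2 < γ) (hγZ : ∀ n : ℤ, γ ≠ n) (K m : ℕ) : ∃ C : ℝ≥0, ∀ (u : Sm) a, Expn u a →
    a 0 = 0 → (lowSum (K + 4) (m + 1) γ u a < ⊤ ∨ (ν : ℝ) - 1 < γ) →
    lowSum (K + 4) (m + 1) γ u a ≤
      C * (lowSum K m γ (opA la lb u) (coefA la lb a) + coefSum (m + 1) γ a) := by
  have hne : ∀ r : ℕ, ∀ c ∈ la ++ lb,
      c ≠ γ + (m + 1 : ℕ) + r ∧ c ≠ γ + (m + 1 : ℕ) + r + 1 := by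
    intro r c hc
    obtain ⟨n, rfl, -⟩ := hroots c hc
    refine ⟨fun e => hγZ (n - (m + 1 : ℕ) - r) ?_, fun e => hγZ (n - (m + 1 : ℕ) - r - 1) ?_⟩ <;>
    · push_cast at e ⊢; linarith
  obtain ⟨C, hC⟩ := exists_sum_le (m + 1) (ι := Sm × (ℕ → ℝ)) _ _ _
    fun r _ => (exists_le_step (lb := lb) h0 K (index_bounds hγ hγZ m r).1
      (index_bounds hγ hγZ m r).2 (hne r)).imp fun C hC (i : Sm × (ℕ → ℝ))
        (hi : Expn i.1 i.2 ∧ i.2 0 = 0 ∧ _) => hC i.1 i.2 hi.1 hi.2.1 hi.2.2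
  refine ⟨C, fun u a hu ha hX => ?_⟩
  rw [lowSum_opA]
  have hle := le_sum_pairs (fun r => sob (K + 4) (γ + (m + 1 : ℕ) + r)
    (u - tay a ⌈γ + (m + 1 : ℕ) + r⌉₊)) m
  have hge := sum_pairs_le (fun r => sob (K + 4) (γ + (m + 1 : ℕ) + r)
    (u - tay a ⌈γ + (m + 1 : ℕ) + r⌉₊)) m
  simp only [← pair_eq hγ] at hle hge
  refine hle.trans ?_
  have main := hC (u, a)
  simp only [add_assoc K, hlen] at main
  refine main fun r hr => ⟨hu, ha, hX.imp (fun h => ?_) fun h c hc => ?_⟩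
  · refine lt_of_le_of_lt ?_ (hge.trans_lt (ENNReal.mul_lt_top (by simp) h))
    exact Finset.single_le_sum (f := fun r : ℕ => sob (K + 4) (γ + (m + 1 : ℕ) + r)
      (u - tay a ⌈γ + (m + 1 : ℕ) + r⌉₊) + sob (K + 4) (γ + (m + 1 : ℕ) + r + 1)
      (u - tay a (⌈γ + (m + 1 : ℕ) + r⌉₊ + 1))) (fun _ _ => zero_le) (Finset.mem_range.2 hr)
  -- The weights used here are at least `γ + 1`, so `γ > ν - 1` already puts every root `≤ ν` below
  -- them.
  · obtain ⟨n, rfl, hn⟩ := hroots c hc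
    have hn' : (n : ℝ) ≤ ν := by exact_mod_cast hn
    have hr0 : (0 : ℝ) ≤ r := r.cast_nonneg
    have hm0 : (0 : ℝ) ≤ m := m.cast_nonneg
    push_cast
    linarith

variable {ν : ℕ}

theorem exists_iterate_le (hlen : la.length + lb.length = 4) (h0 : (0 : ℝ) ∈ la)
    (hν : 0 < ν) (hcoef : ∀ a : ℕ → ℝ, (∀ j < ν, a j = 0) → ∀ j < ν, coefA la lb a j = 0)
    (hγ : -2 < γ) (hγZ : ∀ n : ℤ, γ ≠ n) (k m : ℕ) : ∃ C : ℝ≥0, ∀ (u : Sm) a,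
    (∀ j < ν, a j = 0) →
    sob k γ ((opA la lb)^[m] u - tay ((coefA la lb)^[m] a) ⌈γ⌉₊) + coefSum m γ a ≤
      C * lowSum (k + 4 * m) m γ u a := by
  induction m with
  | zero => exact ⟨1, fun u a _ => by simp [lowSum, coefSum]⟩
  | succ m ih =>
    obtain ⟨C, hC⟩ := ih
    obtain ⟨C', hC'⟩ := exists_lowSum_opA_le (lb := lb) hlen h0 hγ hγZ (k + 4 * m) m
    refine ⟨C * C' + C', fun u a ha => ?_⟩
    have h₁ := hC (opA la lb u) (coefA la lb a) (hcoef a ha)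
    have h₂ := hC' u a (ha 0 hν)
    rw [Function.iterate_succ_apply, Function.iterate_succ_apply]
    set X := lowSum (k + 4 * m + 4) (m + 1) γ u a with hX
    have e : lowSum (k + 4 * (m + 1)) (m + 1) γ u a = X := rfl
    rw [e]
    calc _ ≤ C * (C' * X) + C' * X := by
          refine add_le_add ((le_self_add.trans h₁).trans ?_) (le_add_self.trans h₂)
          gcongr
          exact le_self_add.trans h₂
      _ = _ := by push_cast; ring

/-- The induction peels off the innermost operator. Finiteness passes to `opA la lb u` by the
forward estimate, and its coefficient sum is bounded by `exists_coefSum_coefA_le`. -/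
theorem exists_le_iterate (hlen : la.length + lb.length = 4) (h0 : (0 : ℝ) ∈ la)
    (hν : 0 < ν) (hcoef : ∀ a : ℕ → ℝ, (∀ j < ν, a j = 0) → ∀ j < ν, coefA la lb a j = 0)
    (hroots : ∀ c ∈ la ++ lb, ∃ n : ℕ, c = n ∧ n ≤ ν)
    (hγ : -2 < γ) (hγZ : ∀ n : ℤ, γ ≠ n) (k m : ℕ) : ∃ C : ℝ≥0, ∀ (u : Sm) a, Expn u a →
    (∀ j < ν, a j = 0) → (lowSum (k + 4 * m) m γ u a < ⊤ ∨ (ν : ℝ) - 1 < γ) →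
    lowSum (k + 4 * m) m γ u a ≤
      C * (sob k γ ((opA la lb)^[m] u - tay ((coefA la lb)^[m] a) ⌈γ⌉₊) + coefSum m γ a) := by
  induction m with
  | zero => exact ⟨1, fun u a _ _ _ => by simp [lowSum, coefSum]⟩
  | succ m ih =>
    obtain ⟨C, hC⟩ := ih
    obtain ⟨C₁, h₁⟩ := exists_lowSum_opA_le (lb := lb) hlen h0 hγ hγZ (k + 4 * m) m
    obtain ⟨C₂, h₂⟩ := exists_lowSum_le_opA hlen h0 hroots hγ hγZ (k + 4 * m) m
    obtain ⟨C₃, h₃⟩ := exists_coefSum_coefA_le la lb hγ m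
    refine ⟨C₂ * (C * (1 + C₃) + 1), fun u a hu ha hX => ?_⟩
    rw [Function.iterate_succ_apply, Function.iterate_succ_apply]
    have e : k + 4 * (m + 1) = k + 4 * m + 4 := rfl
    rw [e] at hX ⊢
    have hfin : lowSum (k + 4 * m) m γ (opA la lb u) (coefA la lb a) < ⊤ ∨ (ν : ℝ) - 1 < γ :=
      hX.imp_left fun h => (le_self_add.trans (h₁ u a (ha 0 hν))).trans_lt
        (ENNReal.mul_lt_top ENNReal.coe_lt_top h)
    have i₁ := hC (opA la lb u) (coefA la lb a) (hu.opA h0 (ha 0 hν)) (hcoef a ha) hfin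
    have i₂ := h₂ u a hu (ha 0 hν) hX
    set Y := sob k γ ((opA la lb)^[m] (opA la lb u)
      - tay ((coefA la lb)^[m] (coefA la lb a)) ⌈γ⌉₊)
    set S := coefSum (m + 1) γ a
    calc _ ≤ C₂ * (C * (Y + C₃ * S) + S) := by
          refine i₂.trans ?_
          gcongr
          refine i₁.trans ?_
          gcongr
          exact h₃ a
      _ ≤ C₂ * (C * ((Y + S) + C₃ * (Y + S)) + (Y + S)) := by
          gcongr <;> first | exact le_self_add | exact le_add_self
      _ = _ := by push_cast; ring

end Iterate

/-! ### Combination with the first-order factors -/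

/-- With `j` the first nonzero index, `x^(-j) g → b j`. As `j < γ`, `|x^(-γ) g|` then stays above
`|b j| / 2` near `x = 0`, which a finite norm forbids. -/
theorem Expn.coef_eq_zero {g : Sm} {b : ℕ → ℝ} (hg : Expn g b) {γ : ℝ} (h : wt γ g < ⊤) {j : ℕ}
    (hj : (j : ℝ) < γ) : b j = 0 := by
  induction j using Nat.strong_induction_on with
  | _ j ih =>
    by_contra hb
    have ht : tay b j = 0 := tay_eq_zero fun i hi =>
      ih i hi (lt_trans (by exact_mod_cast hi) hj)
    have h₁ := hg (j + 1)
    rw [tay_succ, ht, zero_add] at h₁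
    have lim : Tendsto (expo (-j) * g).1 atBot (𝓝 (b j)) := by
      have h₂ := (h₁.tendsto (α := j) (by push_cast; linarith)).add_const (b j)
      rw [zero_add] at h₂
      refine h₂.congr fun s => ?_
      have : expo (-j) * (g - b j • expo j) = expo (-j) * g - b j • 1 := by
        rw [mul_sub, mul_smul_comm, ← expo_add, neg_add_cancel, expo_zero]
      rw [this]
      simp
    have hpos : 0 < |b j| / 2 := by have := abs_pos.2 hb; linarith
    have ev : ∀ᶠ s in atBot, |b j| / 2 < |(expo (-j) * g).1 s| :=
      lim.abs.eventually (lt_mem_nhds (by linarith))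
    obtain ⟨T, hT⟩ := eventually_atBot.1 ev
    have hw : wt 0 (expo (-γ) * g) < ⊤ := by rw [wt_expo_mul]; simpa using h
    obtain ⟨s, hs, hlt⟩ := exists_le_abs_lt hw hpos (min T 0)
    have h₃ := hT s (hs.trans (min_le_left _ _))
    have hs0 : s ≤ 0 := hs.trans (min_le_right _ _)
    refine absurd (h₃.trans_le ?_) (not_lt.2 hlt.le)
    rw [Sm.mul_val, Sm.mul_val, abs_mul, abs_mul, expo_val, expo_val,
      abs_of_pos (Real.exp_pos _), abs_of_pos (Real.exp_pos _)]
    gcongr ?_ * _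
    exact Real.exp_le_exp.2 (mul_le_mul_of_nonpos_right (by linarith) hs0)

theorem exists_coefSum_le_lowSum {γ : ℝ} (hγ : -2 < γ) (hγZ : ∀ n : ℤ, γ ≠ n) (K m : ℕ) :
    ∃ C : ℝ≥0, ∀ (f : Sm) a, coefSum m γ a ≤ C * lowSum K m γ f a := by
  cases m with
  | zero => exact ⟨0, fun f a => by simp [coefSum]⟩
  | succ m =>
    obtain ⟨C, hC⟩ := exists_sum_le (m + 1) (ι := Sm × (ℕ → ℝ)) (fun _ _ => True) _ _
      fun r _ => (exists_abs_coef_le K (index_bounds hγ hγZ m r).2).imp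
        fun C hC (i : Sm × (ℕ → ℝ)) _ => hC i.1 i.2
    refine ⟨C * 2, fun f a => (hC (f, a) fun _ _ => trivial).trans ?_⟩
    push_cast
    rw [mul_assoc]
    gcongr
    have := sum_pairs_le (fun r => sob K (γ + (m + 1 : ℕ) + r)
      (f - tay a ⌈γ + (m + 1 : ℕ) + r⌉₊)) m
    simp only [← pair_eq hγ] at this
    push_cast at this
    exact this.trans_eq (by simp [lowSum])

theorem Expn.iterate_opA {la lb : List ℝ} {ν : ℕ} (h0 : (0 : ℝ) ∈ la) (hν : 0 < ν)
    (hcoef : ∀ a : ℕ → ℝ, (∀ j < ν, a j = 0) → ∀ j < ν, coefA la lb a j = 0) (m : ℕ)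
    {u : Sm} {b : ℕ → ℝ} (hu : Expn u b) (hb : ∀ j < ν, b j = 0) :
    Expn ((ThinFilm.opA la lb)^[m] u) ((coefA la lb)^[m] b) ∧
      ∀ j < ν, (coefA la lb)^[m] b j = 0 := by
  induction m generalizing u b with
  | zero => exact ⟨hu, hb⟩
  | succ m ih =>
    rw [Function.iterate_succ_apply, Function.iterate_succ_apply]
    exact ih (hu.opA h0 (hb 0 hν)) (hcoef b hb)

/-- The roots in `l` and `a 0 = 0` annihilate the first `ν` coefficients of `shiftOps l f`, so the
iteration applies to it. Hardy's inequality for `l` then relates its remainders to those of `f`. -/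
theorem exists_equivalence {l la lb : List ℝ} {ν : ℕ} (hlen : la.length + lb.length = 4)
    (h0 : (0 : ℝ) ∈ la) (hν : 0 < ν)
    (hcoef : ∀ a : ℕ → ℝ, (∀ j < ν, a j = 0) → ∀ j < ν, coefA la lb a j = 0)
    (hroots : ∀ c ∈ la ++ lb, ∃ n : ℕ, c = n ∧ n ≤ ν)
    (hl : ∀ c ∈ l, ∃ n : ℕ, c = n ∧ n + 1 ≤ ν)
    (hl' : ∀ j : ℕ, 0 < j → j < ν → (j : ℝ) ∈ l)
    {γ : ℝ} (hγ : -2 < γ) (hγZ : ∀ n : ℤ, γ ≠ n) (k m : ℕ) :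
    ∃ C : ℝ≥0, ∀ (f : Sm) a, Expn f a → a 0 = 0 →
      ((lowSum (k + 4 * m + l.length) m γ f a < ⊤ ∨ (ν : ℝ) - 1 < γ) →
        lowSum (k + 4 * m + l.length) m γ f a ≤
          C * (sob k γ ((opA la lb)^[m] (shiftOps l f)) + coefSum m γ a)) ∧
      ((sob k γ ((opA la lb)^[m] (shiftOps l f)) < ⊤ ∨ γ < ν) →
        sob k γ ((opA la lb)^[m] (shiftOps l f)) + coefSum m γ a ≤
          C * lowSum (k + 4 * m + l.length) m γ f a) := by
  set K := k + 4 * m with hK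
  have hα : ∀ r : ℕ, ∀ n : ℤ, γ + m + r ≠ n := fun r n hn =>
    hγZ (n - m - r) (by push_cast; linarith)
  have hsym : ∀ a : ℕ → ℝ, a 0 = 0 → ∀ j < ν, symb l j * a j = 0 := fun a ha j hj => by
    rcases Nat.eq_zero_or_pos j with rfl | hj0
    · rw [ha, mul_zero]
    · rw [symb_eq_zero (hl' j hj0 hj), zero_mul]
  obtain ⟨C₁, h₁⟩ := exists_sum_le (m + 1) (ι := Sm × (ℕ → ℝ)) (fun _ _ => True)
    (fun i r => sob K (γ + m + r)
      (shiftOps l i.1 - tay (fun j => symb l j * i.2 j) ⌈γ + m + r⌉₊))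
    (fun i r => sob (K + l.length) (γ + m + r) (i.1 - tay i.2 ⌈γ + m + r⌉₊))
    fun r _ => (exists_sob_shiftOps_le l).imp fun C hC i _ => by
      rw [← shiftOps_tay, ← map_sub]
      exact hC _ _ _
  obtain ⟨C₂, h₂⟩ := exists_sum_le (m + 1) (ι := Sm × (ℕ → ℝ))
    (fun i r => Expn i.1 i.2 ∧ (sob (K + l.length) (γ + m + r) (i.1 - tay i.2 ⌈γ + m + r⌉₊) < ⊤
      ∨ ∀ c ∈ l, c < γ + m + r))
    (fun i r => sob (K + l.length) (γ + m + r) (i.1 - tay i.2 ⌈γ + m + r⌉₊))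
    (fun i r => sob K (γ + m + r)
      (shiftOps l i.1 - tay (fun j => symb l j * i.2 j) ⌈γ + m + r⌉₊))
    fun r _ => by
      obtain ⟨C, hC⟩ := exists_sob_le_shiftOps K (α := γ + m + r) (l := l) fun c hc e => by
        obtain ⟨n, rfl, -⟩ := hl c hc
        exact hα r n (by exact_mod_cast e.symm)
      refine ⟨C, fun i hi => ?_⟩
      rw [← shiftOps_tay, ← map_sub]
      refine hC _ (hi.2.imp_right fun h => ⟨h, _, ?_, hi.1 _⟩)
      exact lt_of_le_of_ne (Nat.le_ceil _) fun e => hα r ⌈γ + m + r⌉₊ (by exact_mod_cast e)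
  obtain ⟨C₃, h₃⟩ := exists_sum_le m (ι := ℕ → ℝ) (fun _ _ => True)
    (fun a r => ENNReal.ofReal |symb l ⌈γ + m + r⌉₊ * a ⌈γ + m + r⌉₊|)
    (fun a r => ENNReal.ofReal |a ⌈γ + m + r⌉₊|)
    fun r _ => ⟨|symb l ⌈γ + m + r⌉₊|.toNNReal, fun a _ => by
      rw [abs_mul, ENNReal.ofReal_mul (abs_nonneg _)]
      exact le_rfl⟩
  obtain ⟨C₄, h₄⟩ := exists_coefSum_le_lowSum hγ hγZ (K + l.length) m
  obtain ⟨C₅, h₅⟩ := exists_iterate_le hlen h0 hν hcoef hγ hγZ k m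
  obtain ⟨C₆, h₆⟩ := exists_le_iterate hlen h0 hν hcoef hroots hγ hγZ k m
  refine ⟨C₂ * (C₆ * (1 + C₃)) + (C₅ * C₁ + C₄), fun f a hf ha => ?_⟩
  set u := shiftOps l f with hu
  set b : ℕ → ℝ := fun j => symb l j * a j with hb
  have hub : Expn u b := hf.shiftOps l
  have hbν := hsym a ha
  obtain ⟨hgE, hgν⟩ := hub.iterate_opA h0 hν hcoef m hbν
  set g := (opA la lb)^[m] u with hg
  set d := (coefA la lb)^[m] b with hd
  have tay_fin : sob k γ g < ⊤ → tay d ⌈γ⌉₊ = 0 := fun h => tay_eq_zero fun j hj =>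
    hgE.coef_eq_zero ((wt_le_sob _ _ _).trans_lt h) (Nat.lt_ceil.1 hj)
  have easy : lowSum K m γ u b ≤ C₁ * lowSum (K + l.length) m γ f a :=
    h₁ (f, a) fun _ _ => trivial
  constructor
  · intro hX
    have hX' : lowSum K m γ u b < ⊤ ∨ (ν : ℝ) - 1 < γ := hX.imp_left fun h =>
      easy.trans_lt (ENNReal.mul_lt_top ENNReal.coe_lt_top h)
    have i₂ : lowSum (K + l.length) m γ f a ≤ C₂ * lowSum K m γ u b := by
      refine h₂ (f, a) fun r hr => ⟨hf, hX.imp (fun h => ?_) fun h c hc => ?_⟩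
      · exact (Finset.single_le_sum (f := fun r : ℕ => sob (K + l.length) (γ + m + r)
          (f - tay a ⌈γ + m + r⌉₊)) (fun _ _ => zero_le) (Finset.mem_range.2 hr)).trans_lt h
      · obtain ⟨n, rfl, hn⟩ := hl c hc
        have hn' : (n : ℝ) + 1 ≤ ν := by exact_mod_cast hn
        have hr0 : (0 : ℝ) ≤ r := r.cast_nonneg
        have hm0 : (0 : ℝ) ≤ m := m.cast_nonneg
        linarith
    have i₆ := h₆ u b hub hbν hX'
    have i₃ : coefSum m γ b ≤ C₃ * coefSum m γ a := h₃ a fun _ _ => trivial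
    -- An infinite right-hand side makes the bound trivial; a finite one forces the Taylor
    -- polynomial to vanish.
    have hT : sob k γ (g - tay d ⌈γ⌉₊) ≤ sob k γ g := by
      rcases eq_or_ne (sob k γ g) ⊤ with h | h
      · rw [h]; exact le_top
      · rw [tay_fin h.lt_top, sub_zero]
    set S := coefSum m γ a
    calc _ ≤ C₂ * (C₆ * (sob k γ g + C₃ * S)) := by
          refine i₂.trans ?_
          gcongr
          refine i₆.trans ?_
          gcongr
      _ ≤ C₂ * (C₆ * ((sob k γ g + S) + C₃ * (sob k γ g + S))) := by
          gcongr
          · exact le_self_add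
          · exact le_add_self
      _ = (C₂ * (C₆ * (1 + C₃)) : ℝ≥0) * (sob k γ g + S) := by push_cast; ring
      _ ≤ _ := mul_le_mul' (ENNReal.coe_le_coe.2 le_self_add) le_rfl
  · intro hX
    have hT : tay d ⌈γ⌉₊ = 0 := by
      rcases hX with h | h
      · exact tay_fin h
      · exact tay_eq_zero fun j hj => hgν j (hj.trans_le (Nat.ceil_le.2 h.le))
    have i₅ := h₅ u b hbν
    rw [← hg, ← hd, hT, sub_zero] at i₅
    have i₄ := h₄ f a
    set L := lowSum (K + l.length) m γ f a
    calc _ ≤ C₅ * (C₁ * L) + C₄ * L := by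
          refine add_le_add ((le_self_add.trans i₅).trans ?_) i₄
          gcongr
      _ = (C₅ * C₁ + C₄ : ℝ≥0) * L := by push_cast; ring
      _ ≤ _ := mul_le_mul' (ENNReal.coe_le_coe.2 le_add_self) le_rfl

/-! ### The logarithmic change of variables -/

/-- `f` is the function `u` in the variable `s = log x`. -/
def Rep (u : ℝ → ℝ) (f : Sm) : Prop := ∀ s, u (Real.exp s) = f.1 s

theorem Rep.logD {u : ℝ → ℝ} {f : Sm} (h : Rep u f) : Rep (logD u) (der f) := fun s => by
  have hx := Real.exp_pos s
  have ev : u =ᶠ[𝓝 (Real.exp s)] fun x => f.1 (Real.log x) := by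
    filter_upwards [lt_mem_nhds hx] with x hx'
    rw [← h, Real.exp_log hx']
  have d : HasDerivAt (fun x => f.1 (Real.log x)) ((der f).1 s * (Real.exp s)⁻¹) (Real.exp s) := by
    refine HasDerivAt.comp (Real.exp s) (h₂ := f.1) ?_ (Real.hasDerivAt_log hx.ne')
    rw [Real.log_exp]
    exact hasDerivAt_val f s
  rw [ThinFilm.logD, ev.deriv_eq, d.deriv]
  field_simp

theorem Rep.shiftD {u : ℝ → ℝ} {f : Sm} (c : ℝ) (h : Rep u f) :
    Rep (shiftD c u) (der f - c • f) := fun s => by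
  have := h.logD s
  simp only [ThinFilm.logD] at this
  rw [ThinFilm.shiftD, this, h s]
  rfl

theorem expo_neg_one_val (s : ℝ) : (expo (-1)).1 s = (Real.exp s)⁻¹ := by
  rw [expo_val, neg_one_mul, Real.exp_neg]

/-- Since `(D - c) x⁻¹ = x⁻¹ (D - c - 1)`, moving `D(D-2)` past the inner `x⁻¹` yields `(D-1)(D-3)`.
-/
theorem Rep.tildeA {u : ℝ → ℝ} {f : Sm} (h : Rep u f) :
    Rep (tildeA u) (opA [0, 2] [0, 2] f) := fun s => by
  have e : opA [0, 2] [0, 2] f =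
      expo (-1) * shiftOps [0, 0, 2, 2] f
        + expo (-1) * (expo (-1) * shiftOps [0, 1, 2, 3] f) := by
    rw [opA_apply, oneAddInv_mul]
    simp only [shiftOps_cons, shiftOps_nil, map_sub, map_add, map_smul, der_expo_mul, zero_smul,
      sub_zero, mul_sub, mul_add, mul_smul_comm]
    module
  have h₁ := ((h.shiftD 2).shiftD 2).logD.logD s
  have h₂ := (((h.shiftD 3).shiftD 2).shiftD 1).logD s
  rw [ThinFilm.tildeA, h₁, h₂, e]
  simp only [Sm.add_val, Sm.mul_val, expo_neg_one_val, shiftOps_cons, shiftOps_nil, zero_smul,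
    sub_zero]
  ring

/-- Moving `D(D-2)(D-3)` past the inner `x⁻¹` yields `(D-1)(D-3)(D-4)`. -/
theorem Rep.checkA {u : ℝ → ℝ} {f : Sm} (h : Rep u f) :
    Rep (checkA u) (opA [0, 2, 3] [0] f) := fun s => by
  have e : opA [0, 2, 3] [0] f =
      expo (-1) * shiftOps [0, 0, 2, 3] f
        + expo (-1) * (expo (-1) * shiftOps [0, 1, 3, 4] f) := by
    rw [opA_apply, oneAddInv_mul]
    simp only [shiftOps_cons, shiftOps_nil, map_sub, map_add, map_smul, der_expo_mul, zero_smul,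
      sub_zero, mul_sub, mul_add, mul_smul_comm]
    module
  have h₁ := ((h.shiftD 3).shiftD 2).logD.logD s
  have h₂ := (((h.shiftD 4).shiftD 3).shiftD 1).logD s
  rw [ThinFilm.checkA, h₁, h₂, e]
  simp only [Sm.add_val, Sm.mul_val, expo_neg_one_val, shiftOps_cons, shiftOps_nil, zero_smul,
    sub_zero]
  ring

theorem Rep.iterate {P : (ℝ → ℝ) → ℝ → ℝ} {Q : Module.End ℝ Sm}
    (hPQ : ∀ u f, Rep u f → Rep (P u) (Q f)) (m : ℕ) {u : ℝ → ℝ} {f : Sm} (h : Rep u f) :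
    Rep (P^[m] u) (Q^[m] f) := by
  induction m generalizing u f with
  | zero => exact h
  | succ m ih =>
    rw [Function.iterate_succ_apply, Function.iterate_succ_apply]
    exact ih (hPQ u f h)

theorem sob_eq_sum (k : ℕ) (α : ℝ) (f : Sm) :
    sob k α f = ∑ j ∈ Finset.range (k + 1), wt α (der^[j] f) := by
  induction k generalizing f with
  | zero => simp [sob]
  | succ k ih =>
    rw [Finset.sum_range_succ', sob, ih, add_comm]
    rfl

theorem wnorm_eq {u : ℝ → ℝ} {f : Sm} (h : Rep u f) (k : ℕ) (α : ℝ) :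
    wnorm k α u = (∑ j ∈ Finset.range (k + 1), wt α (der^[j] f) ^ (2 : ℝ)) ^ (1 / 2 : ℝ) := by
  rw [wnorm]
  congr 1
  refine Finset.sum_congr rfl fun j _ => ?_
  have hj : Rep (logD^[j] u) (der^[j] f) := h.iterate (fun _ _ h => h.logD) j
  have img : Set.Ioi (0 : ℝ) = Real.exp '' Set.univ := by simp
  rw [wt_eq_lintegral, ← ENNReal.rpow_mul, img,
    lintegral_image_eq_lintegral_abs_deriv_mul MeasurableSet.univ
      (fun x _ => (Real.hasDerivAt_exp x).hasDerivWithinAt) Real.exp_injective.injOn]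
  norm_num
  refine lintegral_congr fun s => ?_
  rw [← ENNReal.ofReal_mul (Real.exp_pos s).le, hj s, ← Real.exp_mul]
  congr 1
  rw [mul_div_cancel₀ _ (Real.exp_pos s).ne']
  congr 2
  ring

theorem wnorm_le_sob {u : ℝ → ℝ} {f : Sm} (h : Rep u f) (k : ℕ) (α : ℝ) :
    wnorm k α u ≤ sob k α f := by
  rw [wnorm_eq h, sob_eq_sum]
  calc _ ≤ ((∑ j ∈ Finset.range (k + 1), wt α (der^[j] f)) ^ (2 : ℝ)) ^ (1 / 2 : ℝ) := by
        refine ENNReal.rpow_le_rpow ?_ (by norm_num)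
        simp only [show (2 : ℝ) = ((2 : ℕ) : ℝ) by norm_num, ENNReal.rpow_natCast]
        rw [sq, Finset.sum_mul]
        refine Finset.sum_le_sum fun j hj => ?_
        rw [sq]
        gcongr
        exact Finset.single_le_sum (f := fun j => wt α (der^[j] f)) (fun _ _ => zero_le) hj
    _ = _ := by rw [← ENNReal.rpow_mul]; norm_num

theorem sob_le_wnorm {u : ℝ → ℝ} {f : Sm} (h : Rep u f) (k : ℕ) (α : ℝ) :
    sob k α f ≤ (k + 1 : ℕ) * wnorm k α u := by
  rw [wnorm_eq h, sob_eq_sum]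
  refine (Finset.sum_le_card_nsmul _ _
    ((∑ j ∈ Finset.range (k + 1), wt α (der^[j] f) ^ (2 : ℝ)) ^ (1 / 2 : ℝ)) fun j hj => ?_).trans ?_
  · calc wt α (der^[j] f) = (wt α (der^[j] f) ^ (2 : ℝ)) ^ (1 / 2 : ℝ) := by
          rw [← ENNReal.rpow_mul]; norm_num
      _ ≤ _ := by
          refine ENNReal.rpow_le_rpow ?_ (by norm_num)
          exact Finset.single_le_sum (f := fun j => wt α (der^[j] f) ^ (2 : ℝ))
            (fun _ _ => zero_le) hj
  · rw [Finset.card_range, nsmul_eq_mul]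

theorem coeff_zero {w : ℝ → ℝ} (h : w 0 = 0) : coeff w 0 = 0 := by
  simp [coeff, h]

theorem Rep.remainder {w : ℝ → ℝ} {f : Sm} (h : Rep w f) (h0 : w 0 = 0) (n : ℤ) :
    Rep (remainder w n) (f - tay (coeff w) (n + 1).toNat) := fun s => by
  -- The index `j = 0` may be added because `w 0 = 0`; for negative `n` both sums are zero.
  have hsum : ∑ j ∈ Finset.Icc 1 n.toNat, coeff w j * Real.exp s ^ j =
      ∑ j ∈ Finset.range (n + 1).toNat, coeff w j * Real.exp s ^ j := by
    refine Finset.sum_subset (fun j hj => ?_) fun j hj hj' => ?_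
    · rw [Finset.mem_Icc] at hj
      rw [Finset.mem_range]
      omega
    · have : j = 0 := by
        rw [Finset.mem_range] at hj
        rw [Finset.mem_Icc] at hj'
        omega
      rw [this, coeff_zero h0, zero_mul]
  have ht : (tay (coeff w) (n + 1).toNat).1 s =
      ∑ j ∈ Finset.range (n + 1).toNat, coeff w j * Real.exp s ^ j := by
    rw [tay, AddSubmonoidClass.coe_finsetSum, Finset.sum_apply]
    refine Finset.sum_congr rfl fun j _ => ?_
    rw [Sm.smul_val, expo_val, Real.exp_nat_mul]
  rw [ThinFilm.remainder, hsum, Sm.sub_val, ht, h s]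

/-! ### Expansions of functions which are smooth up to `x = 0` -/

section Smooth

variable {w : ℝ → ℝ}

theorem exists_rep (hw : ContDiffOn ℝ ∞ w (Set.Ioi 0)) : ∃ f, Rep w f :=
  ⟨⟨fun s => w (Real.exp s), contDiffOn_univ.1
    (hw.comp Real.contDiff_exp.contDiffOn fun s _ => Real.exp_pos s)⟩, fun _ => rfl⟩

theorem contDiffOn_derivWithin (hw : ContDiffOn ℝ ∞ w (Set.Ici 0)) :
    ContDiffOn ℝ ∞ (derivWithin w (Set.Ici 0)) (Set.Ici 0) :=
  hw.derivWithin (uniqueDiffOn_Ici 0) (by simp)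

/-- The parameter `c` closes the induction: differentiating `x w' + c w` gives `x w'' + (c + 1) w'`.
-/
theorem iteratedDerivWithin_mul_deriv_add (hw : ContDiffOn ℝ ∞ w (Set.Ici 0)) (n : ℕ) (c : ℝ) :
    iteratedDerivWithin n (fun x => x * derivWithin w (Set.Ici 0) x + c * w x) (Set.Ici 0) 0 =
      (n + c) * iteratedDerivWithin n w (Set.Ici 0) 0 := by
  induction n generalizing w c with
  | zero => simp
  | succ n ih =>
    have hw' := contDiffOn_derivWithin hw
    have hd : Set.EqOn (derivWithin (fun x => x * derivWithin w (Set.Ici 0) x + c * w x)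
        (Set.Ici 0)) (fun x => x * derivWithin (derivWithin w (Set.Ici 0)) (Set.Ici 0) x
          + (c + 1) * derivWithin w (Set.Ici 0) x) (Set.Ici 0) := fun x hx => by
      have d₀ := ((hw.differentiableOn (by simp)) x hx).hasDerivWithinAt
      have d₁ := ((hw'.differentiableOn (by simp)) x hx).hasDerivWithinAt
      have d := ((hasDerivWithinAt_id x (Set.Ici 0)).mul d₁).add (d₀.const_mul c)
      refine (d.derivWithin (uniqueDiffOn_Ici 0 x hx)).trans ?_
      simp only [id]
      ring
    rw [iteratedDerivWithin_succ', iteratedDerivWithin_succ',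
      iteratedDerivWithin_congr hd (Set.self_mem_Ici), ih hw']
    push_cast; ring

theorem coeff_mul_deriv (hw : ContDiffOn ℝ ∞ w (Set.Ici 0)) (j : ℕ) :
    coeff (fun x => x * derivWithin w (Set.Ici 0) x) j = j * coeff w j := by
  have := iteratedDerivWithin_mul_deriv_add hw j 0
  simp only [zero_mul, add_zero] at this
  rw [coeff, coeff, this, mul_div_assoc]

theorem Rep.isBigO (hw : ContDiffOn ℝ ∞ w (Set.Ici 0)) {f : Sm} (hf : Rep w f) (J : ℕ) :
    (f - tay (coeff w) J).1 =O[atBot] (expo J).1 := by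
  have lim : Tendsto Real.exp atBot (𝓝[Set.Ici 0] 0) :=
    tendsto_nhdsWithin_iff.2 ⟨Real.tendsto_exp_atBot,
      Eventually.of_forall fun s => (Real.exp_pos s).le⟩
  have h := ((taylor_isLittleO (n := J) (convex_Ici (0 : ℝ)) Set.self_mem_Ici
    (hw.of_le (by exact_mod_cast le_top))).comp_tendsto lim).isBigO
  have e₁ : (fun x : ℝ => (x - 0) ^ J) ∘ Real.exp = (expo J).1 := by
    funext s
    simp [expo_val, Real.exp_nat_mul]
  have e₂ : (fun x => w x - taylorWithinEval w J (Set.Ici 0) 0 x) ∘ Real.exp =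
      (f - tay (coeff w) (J + 1)).1 := by
    funext s
    rw [Function.comp_apply, taylor_within_apply, Sm.sub_val, hf s, tay,
      AddSubmonoidClass.coe_finsetSum, Finset.sum_apply]
    congr 1
    refine Finset.sum_congr rfl fun j _ => ?_
    rw [Sm.smul_val, expo_val, Real.exp_nat_mul, coeff, smul_eq_mul, sub_zero]
    ring
  rw [e₁, e₂] at h
  have e₃ : f - tay (coeff w) J = f - tay (coeff w) (J + 1) + coeff w J • expo J := by
    rw [tay_succ]; abel
  rw [e₃]
  exact h.add ((isBigO_refl (expo J).1 atBot).const_mul_left (coeff w J))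

/-- `D w` is again smooth up to `0`, with coefficients `j w_j`, so Taylor's theorem for `w`
propagates to all derivatives. -/
theorem Rep.expn (hw : ContDiffOn ℝ ∞ w (Set.Ici 0)) {f : Sm} (hf : Rep w f) :
    Expn f (coeff w) := by
  intro J i
  induction i generalizing w f with
  | zero => exact hf.isBigO hw J
  | succ i ih =>
    set v : ℝ → ℝ := fun x => x * derivWithin w (Set.Ici 0) x with hv
    have hvs : ContDiffOn ℝ ∞ v (Set.Ici 0) := contDiffOn_id.mul (contDiffOn_derivWithin hw)
    have hvr : Rep v (der f) := fun s => by
      rw [← hf.logD s, ThinFilm.logD, hv]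
      simp only
      rw [derivWithin_of_mem_nhds (Ici_mem_nhds (Real.exp_pos s))]
    have e : der (f - tay (coeff w) J) = der f - tay (coeff v) J := by
      rw [map_sub]
      congr 1
      simp only [tay, map_sum, map_smul, der_expo, smul_smul, hv, coeff_mul_deriv hw, mul_comm]
    rw [pow_succ, Module.End.mul_apply, e]
    exact ih hvs hvr

end Smooth

/-! ### The sums in the statement -/

theorem toNat_floor_add_one {x : ℝ} (hx : ∀ n : ℤ, x ≠ n) : (⌊x⌋ + 1).toNat = ⌈x⌉₊ := by
  rw [← Int.ceil_toNat, (Int.ceil_eq_floor_add_one_iff_notMem x).2]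
  rintro ⟨n, hn⟩
  exact hx n hn.symm

variable {γ : ℝ}

theorem ceil_eq_toNat (hγZ : ∀ n : ℤ, γ ≠ n) (m r : ℕ) :
    ⌈γ + m + r⌉₊ = (⌊γ⌋ + m + r + 1).toNat := by
  rw [← toNat_floor_add_one, Int.floor_add_natCast, Int.floor_add_natCast]
  intro n hn
  exact hγZ (n - m - r) (by push_cast; linarith)

theorem coeffSum_eq (hγZ : ∀ n : ℤ, γ ≠ n) (m : ℕ) (w : ℝ → ℝ) :
    coeffSum m γ w = coefSum m γ (coeff w) := by
  have hI : Finset.Icc 1 m = Finset.Ico (0 + 1) (m + 1) := by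
    ext j
    simp only [Finset.mem_Icc, Finset.mem_Ico]
    omega
  rw [coeffSum, coefSum, Finset.range_eq_Ico, hI, ← Finset.sum_Ico_add' _ 0 m 1]
  refine Finset.sum_congr rfl fun r _ => ?_
  rw [ceil_eq_toNat hγZ]
  push_cast
  rw [add_assoc (⌊γ⌋ + (m : ℤ))]

theorem remainderSum_le (hγZ : ∀ n : ℤ, γ ≠ n) {w : ℝ → ℝ} {f : Sm} (h : Rep w f) (h0 : w 0 = 0)
    (K m : ℕ) : remainderSum K m γ w ≤ lowSum K m γ f (coeff w) :=
  Finset.sum_le_sum fun r _ => by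
    rw [ceil_eq_toNat hγZ]
    exact wnorm_le_sob (h.remainder h0 _) K _

theorem le_remainderSum (hγZ : ∀ n : ℤ, γ ≠ n) {w : ℝ → ℝ} {f : Sm} (h : Rep w f) (h0 : w 0 = 0)
    (K m : ℕ) : lowSum K m γ f (coeff w) ≤ (K + 1 : ℕ) * remainderSum K m γ w := by
  rw [remainderSum, Finset.mul_sum]
  refine Finset.sum_le_sum fun r _ => ?_
  rw [ceil_eq_toNat hγZ]
  exact sob_le_wnorm (h.remainder h0 _) K _

theorem exists_equivalence_of_rep {l la lb : List ℝ} {ν : ℕ}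
    {P Q : (ℝ → ℝ) → ℝ → ℝ} (hP : ∀ u f, Rep u f → Rep (P u) (opA la lb f))
    (hQ : ∀ u f, Rep u f → Rep (Q u) (shiftOps l f))
    (hlen : la.length + lb.length = 4) (h0 : (0 : ℝ) ∈ la) (hν : 0 < ν)
    (hcoef : ∀ a : ℕ → ℝ, (∀ j < ν, a j = 0) → ∀ j < ν, coefA la lb a j = 0)
    (hroots : ∀ c ∈ la ++ lb, ∃ n : ℕ, c = n ∧ n ≤ ν)
    (hl : ∀ c ∈ l, ∃ n : ℕ, c = n ∧ n + 1 ≤ ν)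
    (hl' : ∀ j : ℕ, 0 < j → j < ν → (j : ℝ) ∈ l)
    (hγ : -2 < γ) (hγZ : ∀ n : ℤ, γ ≠ n) (k m : ℕ) :
    ∃ C : ℝ≥0, ∀ w : ℝ → ℝ, ContDiffOn ℝ ∞ w (Set.Ici 0) → w 0 = 0 →
      ((remainderSum (k + 4 * m + l.length) m γ w < ⊤ ∨ (ν : ℝ) - 1 < γ) →
        remainderSum (k + 4 * m + l.length) m γ w ≤
          C * (wnorm k γ (P^[m] (Q w)) + coeffSum m γ w)) ∧
      ((wnorm k γ (P^[m] (Q w)) < ⊤ ∨ γ < ν) →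
        wnorm k γ (P^[m] (Q w)) + coeffSum m γ w ≤
          C * remainderSum (k + 4 * m + l.length) m γ w) := by
  obtain ⟨C, hC⟩ := exists_equivalence hlen h0 hν hcoef hroots hl hl' hγ hγZ k m
  set K := k + 4 * m + l.length
  refine ⟨C * (k + 1 : ℕ) + C * (K + 1 : ℕ), fun w hw hw0 => ?_⟩
  obtain ⟨f, hf⟩ := exists_rep (hw.mono Set.Ioi_subset_Ici_self)
  obtain ⟨hA, hB⟩ := hC f (coeff w) (hf.expn hw) (coeff_zero hw0)
  have hR : Rep (P^[m] (Q w)) ((opA la lb)^[m] (shiftOps l f)) := (hQ w f hf).iterate hP m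
  have lo := wnorm_le_sob hR k γ
  have hi := sob_le_wnorm hR k γ
  have lo' := remainderSum_le hγZ hf hw0 K m
  have hi' := le_remainderSum hγZ hf hw0 K m
  rw [coeffSum_eq hγZ]
  set S := coefSum m γ (coeff w)
  set R := wnorm k γ (P^[m] (Q w))
  set L := remainderSum K m γ w
  constructor
  · intro hX
    have i := hA (hX.imp_left fun h => hi'.trans_lt (ENNReal.mul_lt_top (by simp) h))
    calc L ≤ C * ((k + 1 : ℕ) * R + (k + 1 : ℕ) * S) := by
          refine lo'.trans (i.trans ?_)
          gcongr
          exact le_mul_of_one_le_left zero_le (by exact_mod_cast Nat.le_add_left 1 k)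
      _ = (C * (k + 1 : ℕ) : ℝ≥0) * (R + S) := by push_cast; ring
      _ ≤ _ := mul_le_mul' (ENNReal.coe_le_coe.2 le_self_add) le_rfl
  · intro hX
    have i := hB (hX.imp_left fun h => hi.trans_lt (ENNReal.mul_lt_top (by simp) h))
    calc R + S ≤ C * ((K + 1 : ℕ) * L) := by
          refine (add_le_add lo le_rfl).trans (i.trans ?_)
          gcongr
      _ = (C * (K + 1 : ℕ) : ℝ≥0) * L := by push_cast; ring
      _ ≤ _ := mul_le_mul' (ENNReal.coe_le_coe.2 le_add_self) le_rfl

/-- At `j = 0` the root `2` of `lb` removes `a 2`; at `j = 1` the root `2` of `la` removes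
everything. -/
theorem coefA_tilde (a : ℕ → ℝ) (ha : ∀ j < 2, a j = 0) :
    ∀ j < 2, coefA [0, 2] [0, 2] a j = 0 := by
  intro j hj
  interval_cases j <;> simp [coefA, symb, ha]
  norm_num

/-- At `j = 0` only `a 1` and `a 2` enter; at `j = 1, 2` the roots `2, 3` of `la` give zero. -/
theorem coefA_check (a : ℕ → ℝ) (ha : ∀ j < 3, a j = 0) :
    ∀ j < 3, coefA [0, 2, 3] [0] a j = 0 := by
  intro j hj
  interval_cases j <;> simp [coefA, symb, ha] <;> norm_num

theorem Rep.tilde {u : ℝ → ℝ} {f : Sm} (h : Rep u f) : Rep (tilde u) (shiftOps [1] f) :=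
  h.shiftD 1

theorem Rep.check {u : ℝ → ℝ} {f : Sm} (h : Rep u f) : Rep (check u) (shiftOps [2, 1] f) :=
  (h.shiftD 1).shiftD 2

end

end ThinFilm

/-! ### The two instances, with `ν = i + 1`. -/

theorem mainTheorem6 (γ : ℝ) (hγ : -2 < γ) (hγZ : ∀ n : ℤ, γ ≠ n) (k m : ℕ) :
    (∃ C : ℝ≥0, ∀ w : ℝ → ℝ, ContDiffOn ℝ ∞ w (Set.Ici 0) → w 0 = 0 →
      ((ThinFilm.remainderSum (k + 4 * m + 1) m γ w < ⊤ ∨ 1 < γ) →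
        ThinFilm.remainderSum (k + 4 * m + 1) m γ w
          ≤ C * (ThinFilm.wnorm k γ (ThinFilm.tildeA^[m] (ThinFilm.tilde w))
              + ThinFilm.coeffSum m γ w)) ∧
      ((ThinFilm.wnorm k γ (ThinFilm.tildeA^[m] (ThinFilm.tilde w)) < ⊤ ∨ γ < 2) →
        ThinFilm.wnorm k γ (ThinFilm.tildeA^[m] (ThinFilm.tilde w)) + ThinFilm.coeffSum m γ w
          ≤ C * ThinFilm.remainderSum (k + 4 * m + 1) m γ w)) ∧
    (∃ C : ℝ≥0, ∀ w : ℝ → ℝ, ContDiffOn ℝ ∞ w (Set.Ici 0) → w 0 = 0 →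
      ((ThinFilm.remainderSum (k + 4 * m + 2) m γ w < ⊤ ∨ 2 < γ) →
        ThinFilm.remainderSum (k + 4 * m + 2) m γ w
          ≤ C * (ThinFilm.wnorm k γ (ThinFilm.checkA^[m] (ThinFilm.check w))
              + ThinFilm.coeffSum m γ w)) ∧
      ((ThinFilm.wnorm k γ (ThinFilm.checkA^[m] (ThinFilm.check w)) < ⊤ ∨ γ < 3) →
        ThinFilm.wnorm k γ (ThinFilm.checkA^[m] (ThinFilm.check w)) + ThinFilm.coeffSum m γ w
          ≤ C * ThinFilm.remainderSum (k + 4 * m + 2) m γ w)) := by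
  constructor
  · obtain ⟨C, hC⟩ := ThinFilm.exists_equivalence_of_rep (l := [1]) (la := [0, 2]) (lb := [0, 2])
      (ν := 2) (fun _ _ h => h.tildeA) (fun _ _ h => h.tilde) rfl (by simp) (by norm_num)
      ThinFilm.coefA_tilde
      (by
        intro c hc
        simp only [List.cons_append, List.nil_append, List.mem_cons, List.not_mem_nil,
          or_false] at hc
        rcases hc with rfl | rfl | rfl | rfl
        · exact ⟨0, by norm_num⟩
        · exact ⟨2, by norm_num⟩
        · exact ⟨0, by norm_num⟩
        · exact ⟨2, by norm_num⟩)
      (by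
        intro c hc
        rw [List.mem_singleton.1 hc]
        exact ⟨1, by norm_num⟩)
      (by
        intro j h₁ h₂
        interval_cases j
        simp)
      hγ hγZ k m
    refine ⟨C, fun w hw hw0 => ?_⟩
    have h := hC w hw hw0
    norm_num at h ⊢
    exact h
  · obtain ⟨C, hC⟩ := ThinFilm.exists_equivalence_of_rep (l := [2, 1]) (la := [0, 2, 3])
      (lb := [0]) (ν := 3) (fun _ _ h => h.checkA) (fun _ _ h => h.check) rfl (by simp)
      (by norm_num) ThinFilm.coefA_check
      (by
        intro c hc
        simp only [List.cons_append, List.nil_append, List.mem_cons, List.not_mem_nil,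
          or_false] at hc
        rcases hc with rfl | rfl | rfl | rfl
        · exact ⟨0, by norm_num⟩
        · exact ⟨2, by norm_num⟩
        · exact ⟨3, by norm_num⟩
        · exact ⟨0, by norm_num⟩)
      (by
        intro c hc
        simp only [List.mem_cons, List.not_mem_nil, or_false] at hc
        rcases hc with rfl | rfl
        · exact ⟨2, by norm_num⟩
        · exact ⟨1, by norm_num⟩)
      (by
        intro j h₁ h₂
        interval_cases j <;> simp)
      hγ hγZ k m
    refine ⟨C, fun w hw hw0 => ?_⟩
    have h := hC w hw hw0
    norm_num at h ⊢
    exact h
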